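/- **Model.** Fix a sampling period $t>0$, a probability space, $N$ drones and $M$ targets. Put $$A_2=\begin{bmatrix} I_2& tI_2\\ 0& I_2\end{bmatrix},\quad B_2=\begin{bmatrix}\tfrac12t^2I_2\\ tI_2\end{bmatrix},\quad F=\begin{bmatrix}1&0&0\\0&1&0\end{bmatrix}.$$ Drone $h$ has a random position $x_h^{(k)}\in\mathbb R^3$, velocity $v_h^{(k)}$ and acceleration $u_h^{(k)}$ with $x_h^{(k+1)}=x_h^{(k)}+tv_h^{(k)}+\tfrac12t^2u_h^{(k)}$, $v_h^{(k+1)}=v_h^{(k)}+tu_h^{(k)}$. Target $j$ has the state $\eta_j=(s_j,\nu_j)\in\mathbb R^4$ with $\eta_j^{(k+1)}=A_2\eta_j^{(k)}+B_2\omega_j^{(k)}$, $\omega_j^{(k)}\sim\mathcal N(0,Q_j)$. Two drones $i=i(j)$, $g=g(j)$ are assigned to target $j$; they measure $d_{h,j}=\|Fx_h-s_j\|+\varepsilon_{h,j}$ ($h=i,g$) with $\varepsilon_{h,j}^{(k)}\sim\mathcal N(0,q_h)$, $q_h>0$, where at each instant $\varepsilon_{i,j},\varepsilon_{g,j}$ are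 independent of each other and jointly independent of the current $(x_i,x_g,\eta_j)$. Let $p_{i,g}=x_i-x_g$, $C_{i,g}=[-2p_{i,g}^\top F^\top,\,0_{1\times2}]$, $$\theta_{i,g,j}=d_{i,j}^2-d_{g,j}^2-x_i^\top F^\top Fx_i+x_g^\top F^\top Fx_g,$$ $$\bar\varepsilon_{i,g,j}=\varepsilon_{i,j}^2-\varepsilon_{g,j}^2+2\|Fx_i-s_j\|\varepsilon_{i,j}-2\|Fx_g-s_j\|\varepsilon_{g,j},\qquad \Upsilon_{i,g,j}=\mathrm{Var}\{\bar\varepsilon_{i,g,j}\},$$ and let $\hat\Upsilon_{i,g,j}^{(k)}$ be the (possibly random) estimate of $\Upsilon_{i,g,j}^{(k)}$ that is available to the estimator. **Estimator (DTSE).** From an initial estimate $\hat\eta_j^{(0)}$ and a positive definite matrix $\zeta_j^{(0)}$ compute, for $k\ge1$, $$\zeta_j^{(k|k-1)}=A_2\zeta_j^{(k-1)}A_2^\top+B_2Q_jB_2^\top,\quad K_j=\zeta_j^{(k|k-1)}C_{i,g}^\top\big(C_{i,g}\zeta_j^{(k|k-1)}C_{i,g}^\top+\hat\Upsilon_{i,g,j}\big)^{-1},\quad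 \zeta_j^{(k)}=(I-K_jC_{i,g})\zeta_j^{(k|k-1)},$$ $$\hat\eta_j^{(k)}=A_2\hat\eta_j^{(k-1)}+K_j\big(\theta_{i,g,j}-C_{i,g}A_2\hat\eta_j^{(k-1)}-(q_i-q_g)\big),$$ and let $e_j=\eta_j-\hat\eta_j$ be the estimation error; assume $\mathbf E\|e_j^{(0)}\|^2<\infty$. **Assumptions.** There are positive constants $\hat q,\check q,\hat r,\check r,\check c$ such that, for all $j$ and $k$, $\hat qI\le Q_j\le\check qI$, $\hat r\le\Upsilon_{i,g,j}\le\check r$ and, almost surely, $\hat r\le\hat\Upsilon_{i,g,j}\le\check r$ and $p_{i,g}p_{i,g}^\top\le\check cI$. **Theorem.** (1) Suppose that for every target $j$ there are constants $\hat\zeta_j,\check\zeta_j>0$ such that almost surely $$\hat\zeta_jI\le(\zeta_j^{(k)})^{-1}\le\check\zeta_jI\quad\text{for all }k>0. \tag{$*$}$$ Then the estimation errors are bounded in mean square: there is $\delta_1\ge0$ with $\mathbf E\|e_j^{(k)}\|^2\le\delta_1$ for all $j$ and all $k\ge0$. (2) The bound $(*)$ holds for target $j$ whenever its two drones use the encirclement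 controller $$u_i=-\tfrac2{t^2}F^\top(Fx_i-\hat s_j-\mathcal P-t\hat\nu_j)+\Gamma_i^{\rm aux}-\tfrac2tv_i,\qquad u_g=-\tfrac2{t^2}F^\top(Fx_g-\hat s_j+\mathcal P-t\hat\nu_j)+\Gamma_g^{\rm aux}-\tfrac2tv_g,$$ where $\hat\eta_j=(\hat s_j,\hat\nu_j)$, $\mathcal P^{(k)}=\rho[\sin(k\pi/\ell),\cos(k\pi/\ell)]^\top$ with $\rho>0$ and an integer $\ell\ge4$, and the additional (interaction and repulsive) pseudo-forces $\Gamma_i^{\rm aux},\Gamma_g^{\rm aux}$ are such that, for some positive integer $m_1$, almost surely for all $k\ge m_1$ the interval $[k-m_1,k]$ contains four consecutive instants at which both vanish. In particular, the conclusion of (1) holds if this is so for every target. -/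

import Mathlib

open MeasureTheory ProbabilityTheory Matrix
open scoped MatrixOrder NNReal

noncomputable section

namespace DTSE

/-- Index set of the target state: `Sum.inl` = planar position, `Sum.inr` = planar velocity. -/
abbrev SIdx := Fin 2 ⊕ Fin 2

/-- Euclidean norm of a coordinate vector. -/
def eNorm {n : Type*} [Fintype n] (v : n → ℝ) : ℝ := ‖WithLp.toLp 2 v‖

/-- Planar double-integrator transition matrix `[[I, t I], [0, I]]`. -/
def A₂ (t : ℝ) : Matrix SIdx SIdx ℝ := fromBlocks 1 (t • 1) 0 1

/-- Planar double-integrator input matrix `[t²/2 I; t I]`. -/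
def B₂ (t : ℝ) : Matrix SIdx (Fin 2) ℝ := fromRows ((t ^ 2 / 2) • 1) (t • 1)

/-- Projection of a position in space onto the ground plane. -/
def F : Matrix (Fin 2) (Fin 3) ℝ := !![1, 0, 0; 0, 1, 0]

/-- The output row `C = [-2 pᵀ Fᵀ, 0]` for the relative drone position `p`. -/
def outRow (p : Fin 3 → ℝ) : SIdx → ℝ := Sum.elim ((-2 : ℝ) • (F *ᵥ p)) 0

/-- Predicted variance `A₂ ζ A₂ᵀ + B₂ Q B₂ᵀ`. -/
def predVar (t : ℝ) (Q : Matrix (Fin 2) (Fin 2) ℝ) (ζ : Matrix SIdx SIdx ℝ) :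
    Matrix SIdx SIdx ℝ :=
  A₂ t * ζ * (A₂ t)ᵀ + B₂ t * Q * (B₂ t)ᵀ

/-- Estimator gain `P Cᵀ (C P Cᵀ + R)⁻¹`, a column since the output is scalar. -/
def gain (P : Matrix SIdx SIdx ℝ) (C : SIdx → ℝ) (R : ℝ) : SIdx → ℝ :=
  (C ⬝ᵥ (P *ᵥ C) + R)⁻¹ • (P *ᵥ C)

/-- The data of a run: `N` drones, `M` targets, all noises and initial values.
Superscripts `(k)` become an argument `k : ℕ`; `ω : Ω` is the sample point. -/
structure Scenario (Ω : Type*) (M N : ℕ) where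
  /-- sampling period -/
  t : ℝ
  /-- drone positions, velocities and controlled accelerations -/
  x : Fin N → ℕ → Ω → Fin 3 → ℝ
  v : Fin N → ℕ → Ω → Fin 3 → ℝ
  u : Fin N → ℕ → Ω → Fin 3 → ℝ
  /-- target states and stochastic target accelerations with their variance matrices -/
  η : Fin M → ℕ → Ω → SIdx → ℝ
  acc : Fin M → ℕ → Ω → Fin 2 → ℝ
  Q : Fin M → Matrix (Fin 2) (Fin 2) ℝ
  /-- distance noises (drone, target) and their variances -/
  ε : Fin N → Fin M → ℕ → Ω → ℝ
  q : Fin N → ℝ≥0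
  /-- the two drones that are assigned to a target -/
  i : Fin M → Fin N
  g : Fin M → Fin N
  /-- the estimate of the output noise variance that is fed to the estimator -/
  Υhat : Fin M → ℕ → Ω → ℝ
  /-- initial estimate and initial variance of the estimator -/
  ηhat₀ : Fin M → Ω → SIdx → ℝ
  ζ₀ : Fin M → Matrix SIdx SIdx ℝ

namespace Scenario

variable {Ω : Type*} {M N : ℕ} (S : Scenario Ω M N)

/-- Target position. -/
def s (j : Fin M) (k : ℕ) (ω : Ω) : Fin 2 → ℝ := fun a => S.η j k ω (Sum.inl a)

/-- True planar distance from drone `h` to target `j`. -/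
def dist (h : Fin N) (j : Fin M) (k : ℕ) (ω : Ω) : ℝ :=
  eNorm (F *ᵥ S.x h k ω - S.s j k ω)

/-- Measured distance. -/
def d (h : Fin N) (j : Fin M) (k : ℕ) (ω : Ω) : ℝ := S.dist h j k ω + S.ε h j k ω

/-- Relative position of the two drones that are assigned to target `j`. -/
def p (j : Fin M) (k : ℕ) (ω : Ω) : Fin 3 → ℝ := S.x (S.i j) k ω - S.x (S.g j) k ω

/-- Output row `C_{i,g}`. -/
def C (j : Fin M) (k : ℕ) (ω : Ω) : SIdx → ℝ := outRow (S.p j k ω)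

/-- The measurement `θ = d_i² - d_g² - x_iᵀFᵀF x_i + x_gᵀFᵀF x_g`. -/
def θ (j : Fin M) (k : ℕ) (ω : Ω) : ℝ :=
  S.d (S.i j) j k ω ^ 2 - S.d (S.g j) j k ω ^ 2
    - (F *ᵥ S.x (S.i j) k ω) ⬝ᵥ (F *ᵥ S.x (S.i j) k ω)
    + (F *ᵥ S.x (S.g j) k ω) ⬝ᵥ (F *ᵥ S.x (S.g j) k ω)

/-- The output noise `ε_i² - ε_g² + 2‖F x_i - s‖ ε_i - 2‖F x_g - s‖ ε_g`. -/
def εbar (j : Fin M) (k : ℕ) (ω : Ω) : ℝ :=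
  S.ε (S.i j) j k ω ^ 2 - S.ε (S.g j) j k ω ^ 2
    + 2 * S.dist (S.i j) j k ω * S.ε (S.i j) j k ω
    - 2 * S.dist (S.g j) j k ω * S.ε (S.g j) j k ω

/-- The Riccati variance `ζ_j` of the estimator. -/
def ζ (j : Fin M) : ℕ → Ω → Matrix SIdx SIdx ℝ
  | 0, _ => S.ζ₀ j
  | k + 1, ω =>
    (1 - vecMulVec (gain (predVar S.t (S.Q j) (ζ j k ω)) (S.C j (k + 1) ω)
          (S.Υhat j (k + 1) ω)) (S.C j (k + 1) ω))
      * predVar S.t (S.Q j) (ζ j k ω)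

/-- The gain used in the step from `k` to `k + 1`. -/
def K (j : Fin M) (k : ℕ) (ω : Ω) : SIdx → ℝ :=
  gain (predVar S.t (S.Q j) (S.ζ j k ω)) (S.C j (k + 1) ω) (S.Υhat j (k + 1) ω)

/-- The state estimate: prediction plus gain times innovation. -/
def ηhat (j : Fin M) : ℕ → Ω → SIdx → ℝ
  | 0, ω => S.ηhat₀ j ω
  | k + 1, ω =>
    A₂ S.t *ᵥ ηhat j k ω
      + (S.θ j (k + 1) ω
          - (S.C j (k + 1) ω ⬝ᵥ (A₂ S.t *ᵥ ηhat j k ω)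
              + (S.q (S.i j) : ℝ) - (S.q (S.g j) : ℝ))) • S.K j k ω

/-- The estimation error. -/
def e (j : Fin M) (k : ℕ) (ω : Ω) : SIdx → ℝ := S.η j k ω - S.ηhat j k ω

/-- Standing model: dynamics of drones and targets, laws of the noises, admissible initial
values. The noises of different instants need not be independent. -/
structure IsModel [MeasurableSpace Ω] (μ : Measure Ω) : Prop where
  t_pos : 0 < S.t
  drone_pos : ∀ h k ω, S.x h (k + 1) ω = S.x h k ω + S.t • S.v h k ω
    + (S.t ^ 2 / 2) • S.u h k ω
  drone_vel : ∀ h k ω, S.v h (k + 1) ω = S.v h k ω + S.t • S.u h k ω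
  target : ∀ j k ω, S.η j (k + 1) ω = A₂ S.t *ᵥ S.η j k ω + B₂ S.t *ᵥ S.acc j k ω
  meas_x : ∀ h k, Measurable (S.x h k)
  meas_η₀ : ∀ j, Measurable (S.η j 0)
  meas_ηhat₀ : ∀ j, Measurable (S.ηhat₀ j)
  meas_acc : ∀ j k, Measurable (S.acc j k)
  meas_ε : ∀ h j k, Measurable (S.ε h j k)
  meas_Υhat : ∀ j k, Measurable (S.Υhat j k)
  acc_law : ∀ j k,
    HasLaw (fun ω => WithLp.toLp 2 (S.acc j k ω)) (multivariateGaussian 0 (S.Q j)) μ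
  q_pos : ∀ h, 0 < S.q h
  ε_law : ∀ h j k, HasLaw (S.ε h j k) (gaussianReal 0 (S.q h)) μ
  ε_indep : ∀ j k, IndepFun (S.ε (S.i j) j k) (S.ε (S.g j) j k) μ
  ε_indep_state : ∀ j k,
    IndepFun (fun ω => (S.ε (S.i j) j k ω, S.ε (S.g j) j k ω))
      (fun ω => (S.x (S.i j) k ω, S.x (S.g j) k ω, S.η j k ω)) μ
  ζ₀_pos : ∀ j, (S.ζ₀ j).PosDef
  init_sq : ∀ j, MemLp (fun ω => WithLp.toLp 2 (S.e j 0 ω)) 2 μ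

/-- Two-sided bounds of the noise variances; the variance estimate obeys the bounds of the
variance it estimates. -/
structure NoiseBounds [MeasurableSpace Ω] (μ : Measure Ω) (qlo qhi rlo rhi : ℝ) : Prop where
  Q_lo : ∀ j, qlo • (1 : Matrix (Fin 2) (Fin 2) ℝ) ≤ S.Q j
  Q_hi : ∀ j, S.Q j ≤ qhi • (1 : Matrix (Fin 2) (Fin 2) ℝ)
  Υ_lo : ∀ j k, rlo ≤ Var[S.εbar j k; μ]
  Υ_hi : ∀ j k, Var[S.εbar j k; μ] ≤ rhi
  Υhat_lo : ∀ j, ∀ᵐ ω ∂μ, ∀ k, rlo ≤ S.Υhat j k ω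
  Υhat_hi : ∀ j, ∀ᵐ ω ∂μ, ∀ k, S.Υhat j k ω ≤ rhi

/-- Two drones of one group stay within bounded distance: `p pᵀ ≤ c I`. -/
def GroupBounded [MeasurableSpace Ω] (μ : Measure Ω) (c : ℝ) : Prop :=
  ∀ j, ∀ᵐ ω ∂μ, ∀ k,
    vecMulVec (S.p j k ω) (S.p j k ω) ≤ c • (1 : Matrix (Fin 3) (Fin 3) ℝ)

/-- Two-sided bound of the inverse Riccati variance of target `j` for all `k > 0`. -/
def VarianceBounded [MeasurableSpace Ω] (μ : Measure Ω) (j : Fin M) : Prop :=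
  ∃ zlo : ℝ, 0 < zlo ∧ ∃ zhi : ℝ, 0 < zhi ∧ ∀ᵐ ω ∂μ, ∀ k : ℕ, 0 < k →
    zlo • (1 : Matrix SIdx SIdx ℝ) ≤ (S.ζ j k ω)⁻¹ ∧
      (S.ζ j k ω)⁻¹ ≤ zhi • (1 : Matrix SIdx SIdx ℝ)

/-- The estimation errors of all targets are bounded in mean square. -/
def MeanSquareBounded [MeasurableSpace Ω] (μ : Measure Ω) : Prop :=
  ∃ δ₁ : ℝ, 0 ≤ δ₁ ∧ ∀ j k, Integrable (fun ω => eNorm (S.e j k ω) ^ 2) μ ∧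
    ∫ ω, eNorm (S.e j k ω) ^ 2 ∂μ ≤ δ₁

/-- Preset encirclement shape `ρ [sin(kπ/ℓ), cos(kπ/ℓ)]`. -/
def shape (ρ : ℝ) (ℓ k : ℕ) : Fin 2 → ℝ :=
  ρ • ![Real.sin (1 / (ℓ : ℝ) * k * Real.pi), Real.cos (1 / (ℓ : ℝ) * k * Real.pi)]

/-- Attractive pseudo-force on drone `h` towards target `j`, with preset relative position `r`:
`-(2/t²) Fᵀ (F x_h - ŝ_j - r - t ν̂_j)`. -/
def attract (h : Fin N) (j : Fin M) (r : Fin 2 → ℝ) (k : ℕ) (ω : Ω) : Fin 3 → ℝ :=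
  (-(2 / S.t ^ 2)) • (Fᵀ *ᵥ (F *ᵥ S.x h k ω - (fun a => S.ηhat j k ω (Sum.inl a)) - r
    - S.t • (fun a => S.ηhat j k ω (Sum.inr a))))

/-- The drones assigned to target `j` use the encirclement controller
`u = Γ_at + Γ_aux - (2/t) v`, on opposite sides of the target; `Γaux h` is the total mutual
interaction and repulsive pseudo-force on drone `h`. -/
def Encircles (ρ : ℝ) (ℓ : ℕ) (Γaux : Fin N → ℕ → Ω → Fin 3 → ℝ) (j : Fin M) : Prop :=
  ∀ k ω,
    S.u (S.i j) k ω = S.attract (S.i j) j (shape ρ ℓ k) k ω + Γaux (S.i j) k ω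
        - (2 / S.t) • S.v (S.i j) k ω ∧
    S.u (S.g j) k ω = S.attract (S.g j) j (-shape ρ ℓ k) k ω + Γaux (S.g j) k ω
        - (2 / S.t) • S.v (S.g j) k ω

/-- Every window `[k - m₁, k]` contains four consecutive instants at which the interaction and
repulsive pseudo-forces on both drones of target `j` vanish. -/
def QuietWindows [MeasurableSpace Ω] (μ : Measure Ω)
    (Γaux : Fin N → ℕ → Ω → Fin 3 → ℝ) (j : Fin M) : Prop :=
  ∃ m₁ : ℕ, 0 < m₁ ∧ ∀ᵐ ω ∂μ, ∀ k ≥ m₁, ∃ k₁, k ≤ k₁ + m₁ ∧ k₁ + 3 ≤ k ∧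
    ∀ n, k₁ ≤ n → n ≤ k₁ + 3 → Γaux (S.i j) n ω = 0 ∧ Γaux (S.g j) n ω = 0

end Scenario

end DTSE

end

/-!
Test vectors `f` are transported backwards in time by the transpose of the noise-free error
dynamics, the dual flow `f ↦ Aᵀ (f - (G ⬝ᵥ f) C)` with `G` the gain. Along it the form `fᵀ Z f` of
the Riccati variance obeys a balance law: in each step it loses exactly the `Q`-energy of the input
that the updated vector sees, plus `R (G ⬝ᵥ f)²`. As the double integrator is controllable in two
steps, the losses over two steps dominate `|f|²`; this bounds `Z` from below, and, where `Z` is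
bounded above, it makes the dual flow a strict contraction for the form.

The vectors `Z f` follow the system forwards, with inputs and outputs paid for by the same losses.
Hence `Z` is bounded above as soon as the outputs over a bounded window determine the state. At a
quiet instant the encirclement controller puts the two drones on opposite sides of the estimated
target, so four consecutive quiet instants give the bearings of the target at four consecutive
angles of a rotation, and these determine position and velocity.

The error is measured by the least `v` with `(f ⬝ᵥ e)² ≤ v fᵀ Z f` for all `f`. In this inverse
variance norm two steps contract, and the noise adds, sample path by sample path, an amount of
bounded expectation, so that dependence between noises of different instants is harmless.
-/

noncomputable section

namespace DTSE

section LoewnerOrder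

variable {n : Type*}

lemma isHermitian_smul_one [DecidableEq n] (a : ℝ) : (a • (1 : Matrix n n ℝ)).IsHermitian := by
  simp [IsHermitian]

lemma transpose_eq_of_isHermitian {Z : Matrix n n ℝ} (hZ : Z.IsHermitian) : Zᵀ = Z := by
  rw [← conjTranspose_eq_transpose_of_trivial, hZ.eq]

lemma smul_one_mono [DecidableEq n] {a b : ℝ} (h : a ≤ b) : a • (1 : Matrix n n ℝ) ≤ b • 1 := by
  rw [Matrix.le_iff, ← sub_smul]
  exact PosSemidef.one.smul (sub_nonneg.2 h)

lemma posDef_of_smul_one_le [DecidableEq n] {Z : Matrix n n ℝ} {a : ℝ} (ha : 0 < a)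
    (h : a • 1 ≤ Z) : Z.PosDef := by
  simpa using (PosDef.one.smul ha).add_posSemidef (Matrix.le_iff.1 h)

variable [Fintype n]

/-- The quadratic form `fᵀ Z f` of a square matrix. -/
def quadForm (Z : Matrix n n ℝ) (f : n → ℝ) : ℝ := f ⬝ᵥ (Z *ᵥ f)

lemma dotProduct_self_nonneg (f : n → ℝ) : 0 ≤ f ⬝ᵥ f :=
  Finset.sum_nonneg fun i _ => mul_self_nonneg (f i)

lemma dotProduct_sq_le (f g : n → ℝ) : (f ⬝ᵥ g) ^ 2 ≤ (f ⬝ᵥ f) * (g ⬝ᵥ g) := by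
  simpa only [dotProduct, sq] using Finset.sum_mul_sq_le_sq_mul_sq Finset.univ f g

lemma eNorm_sq (f : n → ℝ) : eNorm f ^ 2 = f ⬝ᵥ f := by
  rw [eNorm, EuclideanSpace.real_norm_sq_eq]
  simp only [dotProduct, sq]

lemma quadForm_add (Y Z : Matrix n n ℝ) (f : n → ℝ) :
    quadForm (Y + Z) f = quadForm Y f + quadForm Z f := by
  simp only [quadForm, add_mulVec, dotProduct_add]

lemma quadForm_smul_one [DecidableEq n] (a : ℝ) (f : n → ℝ) :
    quadForm (a • (1 : Matrix n n ℝ)) f = a * (f ⬝ᵥ f) := by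
  simp [quadForm, smul_mulVec]

lemma quadForm_mul_mul_transpose {m : Type*} [Fintype m] (A : Matrix m n ℝ) (Z : Matrix n n ℝ)
    (f : m → ℝ) : quadForm (A * Z * Aᵀ) f = quadForm Z (Aᵀ *ᵥ f) := by
  rw [quadForm, quadForm, Matrix.mul_assoc, ← mulVec_mulVec, ← mulVec_mulVec, dotProduct_mulVec,
    ← mulVec_transpose]

lemma quadForm_mul_transpose {m : Type*} [Fintype m] (A : Matrix m n ℝ) (f : m → ℝ) :
    quadForm (A * Aᵀ) f = (Aᵀ *ᵥ f) ⬝ᵥ (Aᵀ *ᵥ f) := by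
  rw [quadForm, ← mulVec_mulVec, dotProduct_mulVec, ← mulVec_transpose]

lemma quadForm_vecMulVec_self (c f : n → ℝ) : quadForm (vecMulVec c c) f = (c ⬝ᵥ f) ^ 2 := by
  simp only [quadForm, vecMulVec_mulVec, op_smul_eq_smul, dotProduct_smul, dotProduct_comm f c,
    smul_eq_mul, sq]

lemma quadForm_nonneg {Z : Matrix n n ℝ} (hZ : Z.PosSemidef) (f : n → ℝ) : 0 ≤ quadForm Z f := by
  simpa [quadForm] using hZ.dotProduct_mulVec_nonneg f

lemma quadForm_mono {Y Z : Matrix n n ℝ} (h : Y ≤ Z) (f : n → ℝ) :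
    quadForm Y f ≤ quadForm Z f := by
  have := quadForm_nonneg (Matrix.le_iff.1 h) f
  rwa [quadForm, sub_mulVec, dotProduct_sub, sub_nonneg] at this

lemma le_of_quadForm_le {Y Z : Matrix n n ℝ} (hY : Y.IsHermitian) (hZ : Z.IsHermitian)
    (h : ∀ f, quadForm Y f ≤ quadForm Z f) : Y ≤ Z := by
  refine Matrix.le_iff.2 (PosSemidef.of_dotProduct_mulVec_nonneg (hZ.sub hY) fun f => ?_)
  simpa [quadForm, sub_mulVec] using h f

lemma le_smul_one_of_quadForm_le [DecidableEq n] {Z : Matrix n n ℝ} (hZ : Z.IsHermitian) {a : ℝ}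
    (h : ∀ f, quadForm Z f ≤ a * (f ⬝ᵥ f)) : Z ≤ a • 1 :=
  le_of_quadForm_le hZ (isHermitian_smul_one a) fun f => by rw [quadForm_smul_one]; exact h f

lemma smul_one_le_of_le_quadForm [DecidableEq n] {Z : Matrix n n ℝ} (hZ : Z.IsHermitian) {a : ℝ}
    (h : ∀ f, a * (f ⬝ᵥ f) ≤ quadForm Z f) : a • 1 ≤ Z :=
  le_of_quadForm_le (isHermitian_smul_one a) hZ fun f => by rw [quadForm_smul_one]; exact h f

lemma quadForm_le_of_le_smul_one [DecidableEq n] {Z : Matrix n n ℝ} {a : ℝ} (h : Z ≤ a • 1)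
    (f : n → ℝ) : quadForm Z f ≤ a * (f ⬝ᵥ f) :=
  quadForm_smul_one a f ▸ quadForm_mono h f

lemma le_quadForm_of_smul_one_le [DecidableEq n] {Z : Matrix n n ℝ} {a : ℝ} (h : a • 1 ≤ Z)
    (f : n → ℝ) : a * (f ⬝ᵥ f) ≤ quadForm Z f :=
  quadForm_smul_one a f ▸ quadForm_mono h f

lemma dotProduct_mulVec_comm {Z : Matrix n n ℝ} (hZ : Z.IsHermitian) (f g : n → ℝ) :
    f ⬝ᵥ (Z *ᵥ g) = g ⬝ᵥ (Z *ᵥ f) := by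
  rw [dotProduct_mulVec, ← mulVec_transpose, transpose_eq_of_isHermitian hZ, dotProduct_comm]

lemma quadForm_sub_smul {Z : Matrix n n ℝ} (hZ : Z.IsHermitian) (c : ℝ) (f g : n → ℝ) :
    quadForm Z (f - c • g) = quadForm Z f - 2 * c * (g ⬝ᵥ (Z *ᵥ f)) + c ^ 2 * quadForm Z g := by
  simp only [quadForm, mulVec_sub, mulVec_smul, dotProduct_sub, sub_dotProduct, smul_dotProduct,
    dotProduct_smul, smul_eq_mul, dotProduct_mulVec_comm hZ f g]
  ring

lemma quadForm_add_le {Z : Matrix n n ℝ} (hZ : Z.PosSemidef) (f g : n → ℝ) :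
    quadForm Z (f + g) ≤ 2 * quadForm Z f + 2 * quadForm Z g := by
  have h_diff := quadForm_nonneg hZ (f - (1 : ℝ) • g)
  have h_sum := quadForm_sub_smul hZ.isHermitian (-1) f g
  rw [neg_one_smul, sub_neg_eq_add] at h_sum
  rw [quadForm_sub_smul hZ.isHermitian] at h_diff
  linarith

lemma dotProduct_self_add_le (f g : n → ℝ) :
    (f + g) ⬝ᵥ (f + g) ≤ 2 * (f ⬝ᵥ f) + 2 * (g ⬝ᵥ g) := by
  classical
  simpa [quadForm] using quadForm_add_le (PosSemidef.one (n := n) (R := ℝ)) f g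

lemma mulVec_sq_le_of_le_smul_one [DecidableEq n] {Z : Matrix n n ℝ} (hZ : Z.PosSemidef) {c : ℝ}
    (hc : 0 < c) (h : Z ≤ c • 1) (f : n → ℝ) : (Z *ᵥ f) ⬝ᵥ (Z *ᵥ f) ≤ c * quadForm Z f := by
  have h_upper := quadForm_le_of_le_smul_one h (Z *ᵥ f)
  have h_nonneg := quadForm_nonneg hZ (Z *ᵥ f - c • f)
  rw [quadForm_sub_smul hZ.isHermitian, dotProduct_mulVec_comm hZ.isHermitian f] at h_nonneg
  refine le_of_mul_le_mul_left ?_ hc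
  linarith

lemma le_smul_one_of_mulVec_sq_le [DecidableEq n] {Z : Matrix n n ℝ} (hZ : Z.IsHermitian) {c : ℝ}
    (hc : 0 < c) (h : ∀ f, (Z *ᵥ f) ⬝ᵥ (Z *ᵥ f) ≤ c * quadForm Z f) : Z ≤ c • 1 := by
  refine le_smul_one_of_quadForm_le hZ fun f => ?_
  have h_nonneg := dotProduct_self_nonneg (Z *ᵥ f - c • f)
  have h_expand : (Z *ᵥ f - c • f) ⬝ᵥ (Z *ᵥ f - c • f)
      = (Z *ᵥ f) ⬝ᵥ (Z *ᵥ f) - 2 * c * quadForm Z f + c ^ 2 * (f ⬝ᵥ f) := by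
    simp only [quadForm, dotProduct_sub, sub_dotProduct, smul_dotProduct, dotProduct_smul,
      smul_eq_mul, dotProduct_comm (Z *ᵥ f) f]
    ring
  refine le_of_mul_le_mul_left ?_ hc
  linarith [h f]

omit [Fintype n] in
lemma exists_le_smul_one [Finite n] [DecidableEq n] {Z : Matrix n n ℝ} (hZ : Z.IsHermitian) :
    ∃ c : ℝ, 1 ≤ c ∧ Z ≤ c • 1 := by
  have := Fintype.ofFinite n
  refine ⟨max 1 ‖toEuclideanCLM (𝕜 := ℝ) Z‖, le_max_left _ _,
    le_smul_one_of_quadForm_le hZ fun f => ?_⟩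
  calc quadForm Z f = inner ℝ (toEuclideanCLM (𝕜 := ℝ) Z (WithLp.toLp 2 f)) (WithLp.toLp 2 f) := by
        simp [quadForm, EuclideanSpace.inner_eq_star_dotProduct]
    _ ≤ ‖toEuclideanCLM (𝕜 := ℝ) Z (WithLp.toLp 2 f)‖ * ‖WithLp.toLp 2 f‖ := real_inner_le_norm _ _
    _ ≤ ‖toEuclideanCLM (𝕜 := ℝ) Z‖ * ‖WithLp.toLp 2 f‖ * ‖WithLp.toLp 2 f‖ := by
        gcongr; exact ContinuousLinearMap.le_opNorm _ _
    _ = ‖toEuclideanCLM (𝕜 := ℝ) Z‖ * (f ⬝ᵥ f) := by rw [← eNorm_sq, eNorm]; ring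
    _ ≤ max 1 ‖toEuclideanCLM (𝕜 := ℝ) Z‖ * (f ⬝ᵥ f) := by
        gcongr
        · exact dotProduct_self_nonneg f
        · exact le_max_right _ _

lemma exists_mulVec_sq_le {m : Type*} [Fintype m] (M : Matrix m n ℝ) :
    ∃ a : ℝ, 0 ≤ a ∧ ∀ f, (M *ᵥ f) ⬝ᵥ (M *ᵥ f) ≤ a * (f ⬝ᵥ f) := by
  classical
  obtain ⟨a, ha, h⟩ := exists_le_smul_one (Z := Mᵀ * Mᵀᵀ) (by simp [IsHermitian])
  refine ⟨a, by linarith, fun f => ?_⟩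
  have := quadForm_le_of_le_smul_one h f
  rwa [quadForm_mul_transpose, transpose_transpose] at this

-- Both sides are Schur complements of the block matrix `[[B, 1], [1, A⁻¹]]`.
lemma inv_le_inv_of_le [DecidableEq n] {A B : Matrix n n ℝ} (hA : A.PosDef) (h : A ≤ B) :
    B⁻¹ ≤ A⁻¹ := by
  have hB : B.PosDef := by simpa using hA.add_posSemidef (Matrix.le_iff.1 h)
  have := hA.inv.isUnit.invertible
  have := hB.isUnit.invertible
  have h_block : (fromBlocks B 1 1ᴴ A⁻¹).PosSemidef := by
    rw [hA.inv.fromBlocks₂₂, nonsing_inv_nonsing_inv _ ((isUnit_iff_isUnit_det _).1 hA.isUnit)]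
    simpa using Matrix.le_iff.1 h
  rw [hB.fromBlocks₁₁] at h_block
  exact Matrix.le_iff.2 (by simpa using h_block)

lemma inv_smul_one [DecidableEq n] {a : ℝ} (ha : 0 < a) :
    (a • (1 : Matrix n n ℝ))⁻¹ = a⁻¹ • 1 :=
  inv_eq_right_inv (by simp [smul_smul, ha.ne'])

lemma inv_le_smul_one [DecidableEq n] {Z : Matrix n n ℝ} {a : ℝ} (ha : 0 < a) (h : a • 1 ≤ Z) :
    Z⁻¹ ≤ a⁻¹ • 1 :=
  inv_smul_one (n := n) ha ▸ inv_le_inv_of_le (PosDef.one.smul ha) h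

lemma smul_one_le_inv [DecidableEq n] {Z : Matrix n n ℝ} (hZ : Z.PosDef) {a : ℝ} (ha : 0 < a)
    (h : Z ≤ a • 1) : a⁻¹ • 1 ≤ Z⁻¹ :=
  inv_smul_one (n := n) ha ▸ inv_le_inv_of_le hZ h

lemma le_smul_one_of_smul_one_le_inv [DecidableEq n] {Z : Matrix n n ℝ} {a : ℝ} (ha : 0 < a)
    (h : a • 1 ≤ Z⁻¹) : Z ≤ a⁻¹ • 1 := by
  have hZ := posDef_inv_iff.1 (posDef_of_smul_one_le ha h)
  simpa only [nonsing_inv_nonsing_inv _ ((isUnit_iff_isUnit_det _).1 hZ.isUnit)]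
    using inv_le_smul_one ha h

omit [Fintype n] in
lemma exists_smul_one_le [Finite n] [DecidableEq n] {Z : Matrix n n ℝ} (hZ : Z.PosDef) :
    ∃ c : ℝ, 0 < c ∧ c • 1 ≤ Z := by
  have := Fintype.ofFinite n
  obtain ⟨c, hc, h⟩ := exists_le_smul_one hZ.inv.isHermitian
  have hc' : 0 < c := by linarith
  refine ⟨c⁻¹, inv_pos.2 hc', ?_⟩
  simpa only [nonsing_inv_nonsing_inv _ ((isUnit_iff_isUnit_det _).1 hZ.isUnit)]
    using smul_one_le_inv hZ.inv hc' h

end LoewnerOrder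

section KalmanStep

variable {n : Type*} [Fintype n] {P : Matrix n n ℝ} {C : n → ℝ} {R : ℝ}

/-- The gain `P Cᵀ (C P Cᵀ + R)⁻¹` of the Kalman filter with one output, in any dimension. -/
def kalmanGain (P : Matrix n n ℝ) (C : n → ℝ) (R : ℝ) : n → ℝ :=
  (C ⬝ᵥ (P *ᵥ C) + R)⁻¹ • (P *ᵥ C)

/-- The a posteriori variance `(1 - K C) P` of the Kalman filter with one output. -/
def kalmanUpdate [DecidableEq n] (P : Matrix n n ℝ) (C : n → ℝ) (R : ℝ) : Matrix n n ℝ :=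
  (1 - vecMulVec (kalmanGain P C R) C) * P

/-- The transpose of the error update `e ↦ (1 - K C) e`, acting on test vectors. -/
def dualUpdate (P : Matrix n n ℝ) (C : n → ℝ) (R : ℝ) (f : n → ℝ) : n → ℝ :=
  f - (kalmanGain P C R ⬝ᵥ f) • C

lemma dualUpdate_add (P : Matrix n n ℝ) (C : n → ℝ) (R : ℝ) (f : n → ℝ) :
    dualUpdate P C R f + (kalmanGain P C R ⬝ᵥ f) • C = f :=
  sub_add_cancel _ _

lemma innovationVariance_pos (hP : P.PosSemidef) (hR : 0 < R) : 0 < C ⬝ᵥ (P *ᵥ C) + R :=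
  add_pos_of_nonneg_of_pos (quadForm_nonneg hP C) hR

variable [DecidableEq n]

lemma kalmanUpdate_eq_sub (hP : P.IsHermitian) :
    kalmanUpdate P C R
      = P - (C ⬝ᵥ (P *ᵥ C) + R)⁻¹ • vecMulVec (P *ᵥ C) (P *ᵥ C) := by
  rw [kalmanUpdate, sub_mul, one_mul, vecMulVec_mul, kalmanGain, smul_vecMulVec,
    ← mulVec_transpose, transpose_eq_of_isHermitian hP]

lemma kalmanUpdate_isHermitian (hP : P.IsHermitian) : (kalmanUpdate P C R).IsHermitian := by
  rw [kalmanUpdate_eq_sub hP, IsHermitian, conjTranspose_eq_transpose_of_trivial, transpose_sub,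
    transpose_smul, transpose_vecMulVec, transpose_eq_of_isHermitian hP]

lemma kalmanUpdate_le (hP : P.PosSemidef) (hR : 0 < R) : kalmanUpdate P C R ≤ P := by
  rw [kalmanUpdate_eq_sub hP.isHermitian, Matrix.le_iff, sub_sub_cancel]
  exact (posSemidef_vecMulVec_self_star (P *ᵥ C)).smul
    (inv_nonneg.2 (innovationVariance_pos hP hR).le)

lemma kalmanUpdate_mulVec (hP : P.IsHermitian) (f : n → ℝ) :
    kalmanUpdate P C R *ᵥ f = P *ᵥ dualUpdate P C R f := by
  rw [kalmanUpdate_eq_sub hP, sub_mulVec, smul_mulVec, vecMulVec_mulVec, dualUpdate, mulVec_sub,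
    mulVec_smul, kalmanGain, smul_dotProduct, op_smul_eq_smul, smul_smul, smul_eq_mul]

lemma dotProduct_kalmanUpdate_mulVec (hP : P.PosSemidef) (hR : 0 < R) (f : n → ℝ) :
    C ⬝ᵥ (kalmanUpdate P C R *ᵥ f) = R * (kalmanGain P C R ⬝ᵥ f) := by
  have h_pos := innovationVariance_pos (C := C) hP hR
  rw [kalmanUpdate_mulVec hP.isHermitian, dualUpdate, mulVec_sub, mulVec_smul, dotProduct_sub,
    dotProduct_smul, dotProduct_mulVec_comm hP.isHermitian C f, dotProduct_comm f, kalmanGain,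
    smul_dotProduct, smul_eq_mul, smul_eq_mul]
  field_simp
  ring

-- Joseph's form of the update, tested on a vector.
lemma quadForm_kalmanUpdate (hP : P.PosSemidef) (hR : 0 < R) (f : n → ℝ) :
    quadForm (kalmanUpdate P C R) f
      = quadForm P (dualUpdate P C R f) + R * (kalmanGain P C R ⬝ᵥ f) ^ 2 := by
  calc quadForm (kalmanUpdate P C R) f
      = (dualUpdate P C R f + (kalmanGain P C R ⬝ᵥ f) • C) ⬝ᵥ (kalmanUpdate P C R *ᵥ f) := by
        rw [dualUpdate_add, quadForm]
    _ = dualUpdate P C R f ⬝ᵥ (P *ᵥ dualUpdate P C R f)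
          + (kalmanGain P C R ⬝ᵥ f) * (R * (kalmanGain P C R ⬝ᵥ f)) := by
        rw [add_dotProduct, smul_dotProduct, dotProduct_kalmanUpdate_mulVec hP hR,
          kalmanUpdate_mulVec hP.isHermitian, smul_eq_mul]
    _ = _ := by rw [quadForm]; ring

lemma kalmanUpdate_posSemidef (hP : P.PosSemidef) (hR : 0 < R) :
    (kalmanUpdate P C R).PosSemidef := by
  refine PosSemidef.of_dotProduct_mulVec_nonneg (kalmanUpdate_isHermitian hP.isHermitian)
    fun f => ?_
  rw [star_trivial, ← quadForm, quadForm_kalmanUpdate hP hR]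
  have := quadForm_nonneg hP (dualUpdate P C R f)
  positivity

lemma smul_one_le_kalmanUpdate {a γ rlo : ℝ} (ha : 0 < a) (hP : a • 1 ≤ P) (hrlo : 0 < rlo)
    (hR : rlo ≤ R) (hC : C ⬝ᵥ C ≤ γ) :
    (2 / a + 2 * γ / rlo)⁻¹ • 1 ≤ kalmanUpdate P C R := by
  have hP_psd := (posDef_of_smul_one_le ha hP).posSemidef
  have hR_pos := hrlo.trans_le hR
  refine smul_one_le_of_le_quadForm (kalmanUpdate_isHermitian hP_psd.isHermitian) fun f => ?_
  set g := dualUpdate P C R f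
  set κ := kalmanGain P C R ⬝ᵥ f
  have hγ : 0 ≤ γ := (dotProduct_self_nonneg C).trans hC
  have h_state : g ⬝ᵥ g ≤ quadForm P g / a := by
    rw [le_div_iff₀' ha]
    exact le_quadForm_of_smul_one_le hP g
  have h_output : κ ^ 2 ≤ R * κ ^ 2 / rlo := by
    rw [le_div_iff₀' hrlo]
    gcongr
  have : 0 ≤ R * κ ^ 2 := by positivity
  have h_state_nonneg := quadForm_nonneg hP_psd g
  rw [inv_mul_le_iff₀ (by positivity), quadForm_kalmanUpdate hP_psd hR_pos]
  calc f ⬝ᵥ f = (g + κ • C) ⬝ᵥ (g + κ • C) := by rw [dualUpdate_add]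
    _ ≤ 2 * (g ⬝ᵥ g) + 2 * ((κ • C) ⬝ᵥ (κ • C)) := dotProduct_self_add_le _ _
    _ = 2 * (g ⬝ᵥ g) + 2 * (κ ^ 2 * (C ⬝ᵥ C)) := by
        simp only [smul_dotProduct, dotProduct_smul, smul_eq_mul]; ring
    _ ≤ 2 * (quadForm P g / a) + 2 * (R * κ ^ 2 / rlo * γ) := by
        have := dotProduct_self_nonneg C
        gcongr
    _ = 2 / a * quadForm P g + 2 * γ / rlo * (R * κ ^ 2) := by ring
    _ ≤ (2 / a + 2 * γ / rlo) * quadForm P g + (2 / a + 2 * γ / rlo) * (R * κ ^ 2) := by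
        gcongr
        · exact le_add_of_nonneg_right (by positivity)
        · exact le_add_of_nonneg_left (by positivity)
    _ = _ := by ring

end KalmanStep

section Prediction

variable {n m : Type*} [Fintype n] [Fintype m]

/-- The variance `A Z Aᵀ + B Q Bᵀ` predicted by the system `x' = A x + B w`. -/
def predCov (A : Matrix n n ℝ) (B : Matrix n m ℝ) (Q : Matrix m m ℝ) (Z : Matrix n n ℝ) :
    Matrix n n ℝ :=
  A * Z * Aᵀ + B * Q * Bᵀ

variable {A : Matrix n n ℝ} {B : Matrix n m ℝ} {Q : Matrix m m ℝ} {Z : Matrix n n ℝ}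

lemma predCov_mulVec (f : n → ℝ) :
    predCov A B Q Z *ᵥ f = A *ᵥ (Z *ᵥ (Aᵀ *ᵥ f)) + B *ᵥ (Q *ᵥ (Bᵀ *ᵥ f)) := by
  simp only [predCov, add_mulVec, mulVec_mulVec, Matrix.mul_assoc]

lemma quadForm_predCov (f : n → ℝ) :
    quadForm (predCov A B Q Z) f = quadForm Z (Aᵀ *ᵥ f) + quadForm Q (Bᵀ *ᵥ f) := by
  rw [predCov, quadForm_add, quadForm_mul_mul_transpose, quadForm_mul_mul_transpose]

omit [Fintype n] in
lemma mul_mul_transpose_posSemidef [Finite n] {Q : Matrix m m ℝ} (hQ : Q.PosSemidef)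
    (B : Matrix n m ℝ) : (B * Q * Bᵀ).PosSemidef := by
  simpa only [conjTranspose_eq_transpose_of_trivial] using hQ.mul_mul_conjTranspose_same B

lemma predCov_posSemidef (hQ : Q.PosSemidef) (hZ : Z.PosSemidef) :
    (predCov A B Q Z).PosSemidef :=
  (mul_mul_transpose_posSemidef hZ A).add (mul_mul_transpose_posSemidef hQ B)

variable [DecidableEq n]

lemma predCov_le_smul_one {κ z : ℝ} (hQ : Q.PosSemidef) (hZ : Z.PosSemidef)
    (hκ : predCov A B Q 1 ≤ κ • 1) (hz : 1 ≤ z) (h : Z ≤ z • 1) :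
    predCov A B Q Z ≤ (κ * z) • 1 := by
  refine le_smul_one_of_quadForm_le (predCov_posSemidef hQ hZ).isHermitian fun f => ?_
  have h_unit := quadForm_le_of_le_smul_one hκ f
  have h_state := quadForm_le_of_le_smul_one h (Aᵀ *ᵥ f)
  have h_noise := quadForm_nonneg hQ (Bᵀ *ᵥ f)
  rw [quadForm_predCov, ← one_smul ℝ (1 : Matrix n n ℝ), quadForm_smul_one, one_mul] at h_unit
  calc quadForm (predCov A B Q Z) f = quadForm Z (Aᵀ *ᵥ f) + quadForm Q (Bᵀ *ᵥ f) :=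
        quadForm_predCov f
    _ ≤ z * ((Aᵀ *ᵥ f) ⬝ᵥ (Aᵀ *ᵥ f)) + z * quadForm Q (Bᵀ *ᵥ f) := by
        gcongr
        exact le_mul_of_one_le_left h_noise hz
    _ = z * ((Aᵀ *ᵥ f) ⬝ᵥ (Aᵀ *ᵥ f) + quadForm Q (Bᵀ *ᵥ f)) := by ring
    _ ≤ z * (κ * (f ⬝ᵥ f)) := by gcongr
    _ = κ * z * (f ⬝ᵥ f) := by ring

lemma smul_one_le_predCov {α a : ℝ} (hQ : Q.PosSemidef) (hα : α • 1 ≤ A * Aᵀ) (ha : 0 < a)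
    (h : a • 1 ≤ Z) : (a * α) • 1 ≤ predCov A B Q Z := by
  have hZ := (posDef_of_smul_one_le ha h).posSemidef
  refine smul_one_le_of_le_quadForm (predCov_posSemidef hQ hZ).isHermitian fun f => ?_
  have h_unit := le_quadForm_of_smul_one_le hα f
  rw [quadForm_mul_transpose] at h_unit
  calc a * α * (f ⬝ᵥ f) = a * (α * (f ⬝ᵥ f)) := by ring
    _ ≤ a * ((Aᵀ *ᵥ f) ⬝ᵥ (Aᵀ *ᵥ f)) := by gcongr
    _ ≤ quadForm Z (Aᵀ *ᵥ f) := le_quadForm_of_smul_one_le h _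
    _ ≤ quadForm (predCov A B Q Z) f := by
        rw [quadForm_predCov]
        exact le_add_of_nonneg_right (quadForm_nonneg hQ _)

end Prediction

section ObservabilityGramian

variable {n : Type*} [Fintype n] [DecidableEq n]

/-- The observability Gramian of the outputs at the `i` instants `k + 1, …, k + i`, as a
quadratic form in the state at `k + i`: the states are recovered from it by powers of `A⁻¹`. -/
def obsGram (A : Matrix n n ℝ) (C : ℕ → n → ℝ) (k : ℕ) : ℕ → Matrix n n ℝ
  | 0 => 0
  | i + 1 => vecMulVec (C (k + i + 1)) (C (k + i + 1)) + A⁻¹ᵀ * obsGram A C k i * A⁻¹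

variable {A : Matrix n n ℝ} {C : ℕ → n → ℝ}

lemma obsGram_posSemidef (k : ℕ) : ∀ i, (obsGram A C k i).PosSemidef
  | 0 => PosSemidef.zero
  | i + 1 => by
    simpa only [obsGram, transpose_transpose, star_trivial] using
      (posSemidef_vecMulVec_self_star (C (k + i + 1))).add
        (mul_mul_transpose_posSemidef (obsGram_posSemidef k i) A⁻¹ᵀ)

lemma quadForm_obsGram_succ (k i : ℕ) (x : n → ℝ) :
    quadForm (obsGram A C k (i + 1)) x
      = (C (k + i + 1) ⬝ᵥ x) ^ 2 + quadForm (obsGram A C k i) (A⁻¹ *ᵥ x) := by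
  have h := quadForm_mul_mul_transpose A⁻¹ᵀ (obsGram A C k i) x
  rw [transpose_transpose] at h
  rw [obsGram, quadForm_add, quadForm_vecMulVec_self, h]

lemma exists_quadForm_obsGram_le (A : Matrix n n ℝ) {γ : ℝ} (hγ : 0 ≤ γ) (i : ℕ) :
    ∃ o : ℝ, 0 ≤ o ∧ ∀ C : ℕ → n → ℝ, (∀ k, C k ⬝ᵥ C k ≤ γ) → ∀ k x,
      quadForm (obsGram A C k i) x ≤ o * (x ⬝ᵥ x) := by
  induction i with
  | zero => exact ⟨0, le_rfl, fun _ _ _ _ => by simp [obsGram, quadForm]⟩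
  | succ i ih =>
    obtain ⟨o, ho, h⟩ := ih
    obtain ⟨a, ha, hA⟩ := exists_mulVec_sq_le A⁻¹
    refine ⟨γ + o * a, by positivity, fun C hC k x => ?_⟩
    have hx := dotProduct_self_nonneg x
    calc quadForm (obsGram A C k (i + 1)) x
        = (C (k + i + 1) ⬝ᵥ x) ^ 2 + quadForm (obsGram A C k i) (A⁻¹ *ᵥ x) :=
          quadForm_obsGram_succ k i x
      _ ≤ γ * (x ⬝ᵥ x) + o * (a * (x ⬝ᵥ x)) := by
          gcongr
          · exact (dotProduct_sq_le _ x).trans (by gcongr; exact hC _)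
          · exact (h C hC k _).trans (by gcongr; exact hA x)
      _ = (γ + o * a) * (x ⬝ᵥ x) := by ring

end ObservabilityGramian

lemma add_sq_le_add_mul_add {p q a b c d : ℝ} (ha : 0 ≤ a) (hb : 0 ≤ b) (hc : 0 ≤ c) (hd : 0 ≤ d)
    (hp : p ^ 2 ≤ a * c) (hq : q ^ 2 ≤ b * d) : (p + q) ^ 2 ≤ (a + b) * (c + d) := by
  have h_cross_sq : (2 * (p * q)) ^ 2 ≤ (a * d + b * c) ^ 2 := by
    have : p ^ 2 * q ^ 2 ≤ (a * c) * (b * d) := by gcongr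
    nlinarith [sq_nonneg (a * d - b * c)]
  have h_cross : 2 * (p * q) ≤ a * d + b * c :=
    (abs_le_of_sq_le_sq' h_cross_sq (by positivity)).2
  nlinarith

lemma add_sq_le_one_add_mul {T : ℝ} (hT : 0 < T) (p q : ℝ) :
    (p + q) ^ 2 ≤ (1 + 1 / (2 * T)) * p ^ 2 + (1 + 2 * T) * q ^ 2 := by
  have h_id : (1 + 1 / (2 * T)) * p ^ 2 + (1 + 2 * T) * q ^ 2 - (p + q) ^ 2
      = (p - 2 * T * q) ^ 2 / (2 * T) := by
    field_simp
    ring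
  have : 0 ≤ (p - 2 * T * q) ^ 2 / (2 * T) := by positivity
  linarith

lemma exists_le_pow {l : ℝ} (hl : 0 < l) (hl₁ : l < 1) (i : ℕ) :
    ∃ r : ℝ, 0 < r ∧ r < 1 ∧ l ≤ r ^ i := by
  set a := (1 - l) / (i + 1)
  have ha_pos : 0 < a := div_pos (by linarith) (by positivity)
  have ha_mul : a * (i + 1) = 1 - l := div_mul_cancel₀ _ (by positivity)
  have hia : 0 ≤ i * a := by positivity
  refine ⟨1 + -a, by nlinarith, by linarith, ?_⟩
  calc l ≤ 1 + i * -a := by linarith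
    _ ≤ (1 + -a) ^ i := one_add_mul_le_pow (by nlinarith) i

section Majorant

/-- The solution of `x' = r x + D ν` that starts from `D v`: with `r < 1` it dominates the
squared estimation error, measured in the inverse variance. -/
def majorant (r D v : ℝ) (ν : ℕ → ℝ) : ℕ → ℝ
  | 0 => D * v
  | k + 1 => r * majorant r D v ν k + D * ν k

variable {r D v : ℝ} {ν : ℕ → ℝ}

lemma majorant_nonneg (hr : 0 ≤ r) (hD : 0 ≤ D) (hv : 0 ≤ v) (hν : ∀ k, 0 ≤ ν k) :
    ∀ k, 0 ≤ majorant r D v ν k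
  | 0 => mul_nonneg hD hv
  | k + 1 => add_nonneg (mul_nonneg hr (majorant_nonneg hr hD hv hν k)) (mul_nonneg hD (hν k))

lemma le_majorant_add (hr : 0 ≤ r) (hr₁ : r ≤ 1) (hD : 0 ≤ D) (hν : ∀ k, 0 ≤ ν k) (k i : ℕ) :
    r ^ i * (majorant r D v ν k + D * ∑ l ∈ Finset.range i, ν (k + l))
      ≤ majorant r D v ν (k + i) := by
  induction i with
  | zero => simp
  | succ i ih =>
    have h_noise : 0 ≤ D * ν (k + i) := mul_nonneg hD (hν _)
    calc r ^ (i + 1) * (majorant r D v ν k + D * ∑ l ∈ Finset.range (i + 1), ν (k + l))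
        = r * (r ^ i * (majorant r D v ν k + D * ∑ l ∈ Finset.range i, ν (k + l)))
            + r ^ (i + 1) * (D * ν (k + i)) := by
          rw [Finset.sum_range_succ]
          ring
      _ ≤ r * majorant r D v ν (k + i) + D * ν (k + i) :=
          add_le_add (mul_le_mul_of_nonneg_left ih hr)
            (mul_le_of_le_one_left h_noise (pow_le_one₀ hr hr₁))

end Majorant

section ErrorBound

variable {n : Type*} [Fintype n]

/-- `v Z - e eᵀ` is nonnegative: the squared error, measured in the inverse variance, is at
most `v`. Stated without `Z⁻¹`, so that it can be propagated along the dual flow. -/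
def ErrorBound (Z : Matrix n n ℝ) (e : n → ℝ) (v : ℝ) : Prop :=
  ∀ f, (f ⬝ᵥ e) ^ 2 ≤ v * quadForm Z f

variable {Z : Matrix n n ℝ} {e : n → ℝ}

lemma ErrorBound.mono {v v' : ℝ} (h : ErrorBound Z e v) (hZ : Z.PosSemidef) (hv : v ≤ v') :
    ErrorBound Z e v' := fun f =>
  (h f).trans (mul_le_mul_of_nonneg_right hv (quadForm_nonneg hZ f))

variable [DecidableEq n]

lemma errorBound_of_smul_one_le {z : ℝ} (hz : 0 < z) (hZ : z • 1 ≤ Z) (e : n → ℝ) :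
    ErrorBound Z e ((e ⬝ᵥ e) / z) := fun f => by
  have he := dotProduct_self_nonneg e
  calc (f ⬝ᵥ e) ^ 2 ≤ (f ⬝ᵥ f) * (e ⬝ᵥ e) := dotProduct_sq_le f e
    _ = (e ⬝ᵥ e) / z * (z * (f ⬝ᵥ f)) := by field_simp
    _ ≤ (e ⬝ᵥ e) / z * quadForm Z f := by
        gcongr
        exact le_quadForm_of_smul_one_le hZ f

lemma ErrorBound.dotProduct_self_le {v z : ℝ} (h : ErrorBound Z e v) (hv : 0 ≤ v) (hz : 0 < z)
    (hZ : Z ≤ z • 1) : e ⬝ᵥ e ≤ z * v := by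
  have h_sq : (e ⬝ᵥ e) ^ 2 ≤ v * (z * (e ⬝ᵥ e)) :=
    (h e).trans (by gcongr; exact quadForm_le_of_le_smul_one hZ e)
  rcases (dotProduct_self_nonneg e).eq_or_lt with he | he
  · rw [← he]
    positivity
  · nlinarith

end ErrorBound

section ControllabilityGramian

variable {n m : Type*} [Fintype n] [Fintype m] {A : Matrix n n ℝ} {B : Matrix n m ℝ}

/-- The `i`-step controllability Gramian `∑_{l<i} A^l B Bᵀ (Aᵀ)^l` of the system
`x' = A x + B w`. -/
def ctrlGram (A : Matrix n n ℝ) (B : Matrix n m ℝ) : ℕ → Matrix n n ℝ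
  | 0 => 0
  | i + 1 => A * ctrlGram A B i * Aᵀ + B * Bᵀ

lemma ctrlGram_posSemidef (A : Matrix n n ℝ) (B : Matrix n m ℝ) :
    ∀ i, (ctrlGram A B i).PosSemidef
  | 0 => PosSemidef.zero
  | i + 1 => by
    simpa only [ctrlGram, conjTranspose_eq_transpose_of_trivial] using
      (mul_mul_transpose_posSemidef (ctrlGram_posSemidef A B i) A).add
        (posSemidef_self_mul_conjTranspose B)

lemma quadForm_ctrlGram_succ (i : ℕ) (f : n → ℝ) :
    quadForm (ctrlGram A B (i + 1)) f
      = quadForm (ctrlGram A B i) (Aᵀ *ᵥ f) + (Bᵀ *ᵥ f) ⬝ᵥ (Bᵀ *ᵥ f) := by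
  rw [ctrlGram, quadForm_add, quadForm_mul_mul_transpose, quadForm_mul_transpose]

end ControllabilityGramian

/-- The data of a Kalman filter for the system `x' = A x + B w`, `w ~ (0, Q)`, with initial
variance `Z₀` and one time-varying output `C k` with noise variance `R k`. -/
structure KalmanFilter {n m : Type*} (A : Matrix n n ℝ) (B : Matrix n m ℝ) (Q : Matrix m m ℝ)
    (Z₀ : Matrix n n ℝ) where
  C : ℕ → n → ℝ
  R : ℕ → ℝ

namespace KalmanFilter

section Admissible

variable {n m : Type*} {A : Matrix n n ℝ} {B : Matrix n m ℝ} {Q : Matrix m m ℝ}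
  {Z₀ : Matrix n n ℝ} {K : KalmanFilter A B Q Z₀}

/-- The noise variances are nonnegative, those of the output even positive. -/
structure Admissible (K : KalmanFilter A B Q Z₀) : Prop where
  Q_posSemidef : Q.PosSemidef
  Z₀_posSemidef : Z₀.PosSemidef
  R_pos : ∀ k, 0 < K.R k

lemma admissible_of_le [DecidableEq m] {qlo rlo : ℝ} (hqlo : 0 < qlo) (hQ : qlo • 1 ≤ Q)
    (hZ₀ : Z₀.PosSemidef) (hrlo : 0 < rlo) (hR : ∀ k, rlo ≤ K.R k) : K.Admissible :=
  ⟨(posDef_of_smul_one_le hqlo hQ).posSemidef, hZ₀, fun k => hrlo.trans_le (hR k)⟩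

end Admissible

variable {n m : Type*} [Fintype n] [DecidableEq n] [Fintype m]
  {A : Matrix n n ℝ} {B : Matrix n m ℝ} {Q : Matrix m m ℝ} {Z₀ : Matrix n n ℝ}

/-- The a posteriori variance. -/
def Z (K : KalmanFilter A B Q Z₀) : ℕ → Matrix n n ℝ
  | 0 => Z₀
  | k + 1 => kalmanUpdate (predCov A B Q (K.Z k)) (K.C (k + 1)) (K.R (k + 1))

/-- The gain of the step from `k` to `k + 1`. -/
def gain (K : KalmanFilter A B Q Z₀) (k : ℕ) : n → ℝ :=
  kalmanGain (predCov A B Q (K.Z k)) (K.C (k + 1)) (K.R (k + 1))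

/-- The transpose of the a posteriori error update of the step from `k` to `k + 1`. -/
def dualUpdate (K : KalmanFilter A B Q Z₀) (k : ℕ) (f : n → ℝ) : n → ℝ :=
  DTSE.dualUpdate (predCov A B Q (K.Z k)) (K.C (k + 1)) (K.R (k + 1)) f

/-- The transpose of the noise-free error dynamics `e ↦ (1 - K C) A e` from `k` to `k + 1`;
it runs backwards, from `k + 1` to `k`. -/
def dualStep (K : KalmanFilter A B Q Z₀) (k : ℕ) (f : n → ℝ) : n → ℝ :=
  Aᵀ *ᵥ K.dualUpdate k f

/-- The transpose of the noise-free error dynamics from `k` to `k + i`. -/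
def dualFlow (K : KalmanFilter A B Q Z₀) : ℕ → ℕ → (n → ℝ) → n → ℝ
  | 0, _, f => f
  | i + 1, k, f => K.dualFlow i k (K.dualStep (k + i) f)

variable {K : KalmanFilter A B Q Z₀}

lemma dualUpdate_add (k : ℕ) (f : n → ℝ) :
    K.dualUpdate k f + (K.gain k ⬝ᵥ f) • K.C (k + 1) = f :=
  DTSE.dualUpdate_add _ _ _ f

lemma Z_posSemidef (hK : K.Admissible) : ∀ k, (K.Z k).PosSemidef
  | 0 => hK.Z₀_posSemidef
  | k + 1 => kalmanUpdate_posSemidef (predCov_posSemidef hK.Q_posSemidef (Z_posSemidef hK k))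
      (hK.R_pos _)

lemma predCov_Z_posSemidef (hK : K.Admissible) (k : ℕ) : (predCov A B Q (K.Z k)).PosSemidef :=
  predCov_posSemidef hK.Q_posSemidef (Z_posSemidef hK k)

lemma Z_succ_mulVec (hK : K.Admissible) (k : ℕ) (f : n → ℝ) :
    K.Z (k + 1) *ᵥ f
      = A *ᵥ (K.Z k *ᵥ K.dualStep k f) + B *ᵥ (Q *ᵥ (Bᵀ *ᵥ K.dualUpdate k f)) := by
  rw [Z, kalmanUpdate_mulVec (predCov_Z_posSemidef hK k).isHermitian, predCov_mulVec]
  rfl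

lemma C_dotProduct_Z_succ_mulVec (hK : K.Admissible) (k : ℕ) (f : n → ℝ) :
    K.C (k + 1) ⬝ᵥ (K.Z (k + 1) *ᵥ f) = K.R (k + 1) * (K.gain k ⬝ᵥ f) :=
  dotProduct_kalmanUpdate_mulVec (predCov_Z_posSemidef hK k) (hK.R_pos _) f

lemma quadForm_Z_succ (hK : K.Admissible) (k : ℕ) (f : n → ℝ) :
    quadForm (K.Z (k + 1)) f = quadForm (K.Z k) (K.dualStep k f)
      + quadForm Q (Bᵀ *ᵥ K.dualUpdate k f) + K.R (k + 1) * (K.gain k ⬝ᵥ f) ^ 2 := by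
  rw [Z, quadForm_kalmanUpdate (predCov_Z_posSemidef hK k) (hK.R_pos _), quadForm_predCov]
  rfl

lemma quadForm_Q_le_decrement (hK : K.Admissible) (k : ℕ) (f : n → ℝ) :
    quadForm Q (Bᵀ *ᵥ K.dualUpdate k f)
      ≤ quadForm (K.Z (k + 1)) f - quadForm (K.Z k) (K.dualStep k f) := by
  have := hK.R_pos (k + 1)
  have : 0 ≤ K.R (k + 1) * (K.gain k ⬝ᵥ f) ^ 2 := by positivity
  linarith [quadForm_Z_succ hK k f]

lemma gain_sq_le_decrement (hK : K.Admissible) (k : ℕ) (f : n → ℝ) :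
    K.R (k + 1) * (K.gain k ⬝ᵥ f) ^ 2
      ≤ quadForm (K.Z (k + 1)) f - quadForm (K.Z k) (K.dualStep k f) := by
  linarith [quadForm_Z_succ hK k f, quadForm_nonneg hK.Q_posSemidef (Bᵀ *ᵥ K.dualUpdate k f)]

lemma quadForm_dualStep_le (hK : K.Admissible) (k : ℕ) (f : n → ℝ) :
    quadForm (K.Z k) (K.dualStep k f) ≤ quadForm (K.Z (k + 1)) f := by
  linarith [quadForm_Q_le_decrement hK k f,
    quadForm_nonneg hK.Q_posSemidef (Bᵀ *ᵥ K.dualUpdate k f)]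

lemma quadForm_dualFlow_le (hK : K.Admissible) (k : ℕ) :
    ∀ i f, quadForm (K.Z k) (K.dualFlow i k f) ≤ quadForm (K.Z (k + i)) f
  | 0, _ => le_rfl
  | i + 1, f => (quadForm_dualFlow_le hK k i _).trans (quadForm_dualStep_le hK (k + i) f)

section Controllability

variable {qlo rlo γ : ℝ}

-- Splitting `f = g + κ C` into its dual update and an output component, the Gramian at `g` is
-- controlled by the earlier steps and the noise input, and `κ` by the output.
lemma quadForm_ctrlGram_succ_le [DecidableEq m] {a : ℝ} (hK : K.Admissible) (hqlo : 0 < qlo)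
    (hQ : qlo • 1 ≤ Q) (hrlo : 0 < rlo) {k : ℕ} (hR : rlo ≤ K.R (k + 1))
    (hC : K.C (k + 1) ⬝ᵥ K.C (k + 1) ≤ γ) (i : ℕ) (ha : 0 < a)
    (hW : ctrlGram A B (i + 1) ≤ a • 1) (f : n → ℝ) :
    quadForm (ctrlGram A B (i + 1)) f ≤ 2 * quadForm (ctrlGram A B i) (K.dualStep k f)
      + (2 / qlo + 2 * (a * γ) / rlo)
        * (quadForm (K.Z (k + 1)) f - quadForm (K.Z k) (K.dualStep k f)) := by
  set g := K.dualUpdate k f with hg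
  set κ := K.gain k ⬝ᵥ f
  set Δ := quadForm (K.Z (k + 1)) f - quadForm (K.Z k) (K.dualStep k f)
  have h_input : (Bᵀ *ᵥ g) ⬝ᵥ (Bᵀ *ᵥ g) ≤ Δ / qlo := by
    rw [le_div_iff₀' hqlo]
    exact (le_quadForm_of_smul_one_le hQ _).trans (quadForm_Q_le_decrement hK k f)
  have h_output : κ ^ 2 ≤ Δ / rlo := by
    rw [le_div_iff₀' hrlo]
    exact (mul_le_mul_of_nonneg_right hR (sq_nonneg κ)).trans (gain_sq_le_decrement hK k f)
  have h_direction : quadForm (ctrlGram A B (i + 1)) (κ • K.C (k + 1)) ≤ a * γ * κ ^ 2 := by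
    refine (quadForm_le_of_le_smul_one hW _).trans ?_
    simp only [smul_dotProduct, dotProduct_smul, smul_eq_mul]
    nlinarith [mul_le_mul_of_nonneg_left hC (mul_nonneg ha.le (sq_nonneg κ))]
  have hγ : 0 ≤ γ := (dotProduct_self_nonneg _).trans hC
  calc quadForm (ctrlGram A B (i + 1)) f
      = quadForm (ctrlGram A B (i + 1)) (g + κ • K.C (k + 1)) := by rw [hg, dualUpdate_add]
    _ ≤ 2 * quadForm (ctrlGram A B (i + 1)) g
          + 2 * quadForm (ctrlGram A B (i + 1)) (κ • K.C (k + 1)) :=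
        quadForm_add_le (ctrlGram_posSemidef A B _) _ _
    _ ≤ 2 * (quadForm (ctrlGram A B i) (K.dualStep k f) + Δ / qlo) + 2 * (a * γ * (Δ / rlo)) := by
        rw [quadForm_ctrlGram_succ, dualStep]
        gcongr
        exact h_direction.trans (by gcongr)
    _ = _ := by ring

lemma exists_quadForm_ctrlGram_le [DecidableEq m] (A : Matrix n n ℝ) (B : Matrix n m ℝ)
    (hqlo : 0 < qlo) (hrlo : 0 < rlo) (hγ : 0 ≤ γ) (i : ℕ) :
    ∃ κ : ℝ, 0 ≤ κ ∧ ∀ {Q : Matrix m m ℝ} {Z₀ : Matrix n n ℝ} (K : KalmanFilter A B Q Z₀),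
      K.Admissible → qlo • 1 ≤ Q → (∀ k, rlo ≤ K.R k) → (∀ k, K.C k ⬝ᵥ K.C k ≤ γ) → ∀ k f,
      quadForm (ctrlGram A B i) f
        ≤ κ * (quadForm (K.Z (k + i)) f - quadForm (K.Z k) (K.dualFlow i k f)) := by
  induction i with
  | zero => exact ⟨0, le_rfl, fun _ _ _ _ _ _ _ => by simp [ctrlGram, quadForm]⟩
  | succ i ih =>
    obtain ⟨κ, hκ, h⟩ := ih
    obtain ⟨a, ha, hW⟩ := exists_le_smul_one (ctrlGram_posSemidef A B (i + 1)).isHermitian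
    refine ⟨2 * κ + (2 / qlo + 2 * (a * γ) / rlo), by positivity, ?_⟩
    intro Q Z₀ K hK hQ hR hC k f
    have h_step := quadForm_ctrlGram_succ_le hK hqlo hQ hrlo (hR (k + i + 1)) (hC (k + i + 1)) i
      (by linarith) hW f
    have h_past := h K hK hQ hR hC k (K.dualStep (k + i) f)
    have h_last := quadForm_dualStep_le hK (k + i) f
    have h_first := quadForm_dualFlow_le hK k i (K.dualStep (k + i) f)
    have hc : 0 ≤ 2 / qlo + 2 * (a * γ) / rlo := by positivity
    rw [← Nat.add_assoc k i 1, dualFlow]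
    nlinarith [mul_nonneg hκ (sub_nonneg.2 h_last), mul_nonneg hc (sub_nonneg.2 h_first)]

lemma exists_dotProduct_self_le_decrement [DecidableEq m] {i : ℕ}
    (hAB : (ctrlGram A B i).PosDef) (hqlo : 0 < qlo) (hrlo : 0 < rlo) (hγ : 0 ≤ γ) :
    ∃ L : ℝ, 0 < L ∧ ∀ {Q : Matrix m m ℝ} {Z₀ : Matrix n n ℝ} (K : KalmanFilter A B Q Z₀),
      K.Admissible → qlo • 1 ≤ Q → (∀ k, rlo ≤ K.R k) → (∀ k, K.C k ⬝ᵥ K.C k ≤ γ) → ∀ k f,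
      f ⬝ᵥ f ≤ L * (quadForm (K.Z (k + i)) f - quadForm (K.Z k) (K.dualFlow i k f)) := by
  obtain ⟨c, hc, hW⟩ := exists_smul_one_le hAB
  obtain ⟨κ, hκ, h⟩ := exists_quadForm_ctrlGram_le A B hqlo hrlo hγ i
  refine ⟨(κ + 1) / c, by positivity, fun K hK hQ hR hC k f => ?_⟩
  have h_drop := sub_nonneg.2 (quadForm_dualFlow_le hK k i f)
  rw [div_mul_eq_mul_div, le_div_iff₀' hc]
  calc c * (f ⬝ᵥ f) ≤ quadForm (ctrlGram A B i) f := le_quadForm_of_smul_one_le hW f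
    _ ≤ κ * _ := h K hK hQ hR hC k f
    _ ≤ _ := by gcongr; linarith

lemma exists_smul_one_le_Z_of_le {a α : ℝ} (hα : 0 < α) (hA : α • 1 ≤ A * Aᵀ) (ha : 0 < a)
    (hZ₀ : a • 1 ≤ Z₀) (hQ : Q.PosSemidef) (hrlo : 0 < rlo) (hγ : 0 ≤ γ) (i : ℕ) :
    ∃ z : ℝ, 0 < z ∧ ∀ K : KalmanFilter A B Q Z₀,
      (∀ k, rlo ≤ K.R k) → (∀ k, K.C k ⬝ᵥ K.C k ≤ γ) → ∀ k ≤ i, z • 1 ≤ K.Z k := by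
  induction i with
  | zero => exact ⟨a, ha, fun K _ _ k hk => by obtain rfl := Nat.le_zero.1 hk; exact hZ₀⟩
  | succ i ih =>
    obtain ⟨z, hz, h⟩ := ih
    have hz' : 0 < (2 / (z * α) + 2 * γ / rlo)⁻¹ := by positivity
    refine ⟨min z (2 / (z * α) + 2 * γ / rlo)⁻¹, lt_min hz hz', fun K hR hC k hk => ?_⟩
    rcases Nat.le_succ_iff.1 hk with hk | rfl
    · exact (smul_one_mono (min_le_left _ _)).trans (h K hR hC k hk)
    · exact (smul_one_mono (min_le_right _ _)).trans <|
        smul_one_le_kalmanUpdate (by positivity)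
          (smul_one_le_predCov hQ hA hz (h K hR hC i le_rfl)) hrlo (hR _) (hC _)

lemma exists_smul_one_le_Z [DecidableEq m] {i : ℕ} (hAB : (ctrlGram A B i).PosDef)
    (hA : IsUnit A) (hqlo : 0 < qlo) (hQ : qlo • 1 ≤ Q) (hZ₀ : Z₀.PosDef)
    (hrlo : 0 < rlo) (hγ : 0 ≤ γ) :
    ∃ z : ℝ, 0 < z ∧ ∀ K : KalmanFilter A B Q Z₀,
      (∀ k, rlo ≤ K.R k) → (∀ k, K.C k ⬝ᵥ K.C k ≤ γ) → ∀ k, z • 1 ≤ K.Z k := by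
  have hAA : (A * Aᵀ).PosDef := by
    rw [← conjTranspose_eq_transpose_of_trivial]
    exact PosDef.mul_conjTranspose_self A (vecMul_injective_of_isUnit hA)
  obtain ⟨α, hα, hα_le⟩ := exists_smul_one_le hAA
  obtain ⟨a, ha, ha_le⟩ := exists_smul_one_le hZ₀
  obtain ⟨L, hL, hL_le⟩ := exists_dotProduct_self_le_decrement hAB hqlo hrlo hγ
  obtain ⟨z, hz, hz_le⟩ := exists_smul_one_le_Z_of_le (B := B) hα hα_le ha ha_le
    (posDef_of_smul_one_le hqlo hQ).posSemidef hrlo hγ i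
  refine ⟨min z L⁻¹, lt_min hz (inv_pos.2 hL), fun K hR hC k => ?_⟩
  have hK := admissible_of_le hqlo hQ hZ₀.posSemidef hrlo hR
  rcases le_total k i with hk | hk
  · exact (smul_one_mono (min_le_left _ _)).trans (hz_le K hR hC k hk)
  · refine (smul_one_mono (min_le_right _ _)).trans <|
      smul_one_le_of_le_quadForm (Z_posSemidef hK k).isHermitian fun f => ?_
    obtain ⟨k, rfl⟩ := Nat.exists_eq_add_of_le' hk
    rw [inv_mul_le_iff₀ hL]
    refine (hL_le K hK hQ hR hC k f).trans ?_
    gcongr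
    exact sub_le_self _ (quadForm_nonneg (Z_posSemidef hK k) _)

end Controllability

section UpperBound

lemma C_dotProduct_Z_succ_mulVec_sq_le (hK : K.Admissible) {rhi : ℝ} (hR : ∀ k, K.R k ≤ rhi)
    (k : ℕ) (f : n → ℝ) :
    (K.C (k + 1) ⬝ᵥ (K.Z (k + 1) *ᵥ f)) ^ 2 ≤ rhi * quadForm (K.Z (k + 1)) f := by
  have hR_pos := hK.R_pos (k + 1)
  have h_drop := gain_sq_le_decrement hK k f
  have h_past := quadForm_nonneg (Z_posSemidef hK k) (K.dualStep k f)
  rw [C_dotProduct_Z_succ_mulVec hK]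
  calc (K.R (k + 1) * (K.gain k ⬝ᵥ f)) ^ 2
      = K.R (k + 1) * (K.R (k + 1) * (K.gain k ⬝ᵥ f) ^ 2) := by ring
    _ ≤ rhi * quadForm (K.Z (k + 1)) f :=
        mul_le_mul (hR _) (by linarith) (by positivity) (hR_pos.le.trans (hR _))

lemma smoothedInput_sq_le [DecidableEq m] (hK : K.Admissible) {qhi : ℝ} (hqhi : 0 < qhi)
    (hQ : Q ≤ qhi • 1) (k : ℕ) (f : n → ℝ) :
    (Q *ᵥ (Bᵀ *ᵥ K.dualUpdate k f)) ⬝ᵥ (Q *ᵥ (Bᵀ *ᵥ K.dualUpdate k f))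
      ≤ qhi * quadForm (K.Z (k + 1)) f := by
  refine (mulVec_sq_le_of_le_smul_one hK.Q_posSemidef hqhi hQ _).trans ?_
  have h_past := quadForm_nonneg (Z_posSemidef hK k) (K.dualStep k f)
  gcongr
  linarith [quadForm_Q_le_decrement hK k f]

-- The vectors `Z k *ᵥ f` follow the system when `f` follows the dual flow, with an input and
-- with outputs that are both dominated by the quadratic form.
lemma exists_quadForm_obsGram_Z_mulVec_le [DecidableEq m] (A : Matrix n n ℝ) (hA : IsUnit A)
    (B : Matrix n m ℝ) {qhi rhi γ : ℝ} (hqhi : 0 < qhi) (hrhi : 0 < rhi) (hγ : 0 ≤ γ) (i : ℕ) :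
    ∃ κ : ℝ, 0 ≤ κ ∧ ∀ {Q : Matrix m m ℝ} {Z₀ : Matrix n n ℝ} (K : KalmanFilter A B Q Z₀),
      K.Admissible → Q ≤ qhi • 1 → (∀ k, K.R k ≤ rhi) → (∀ k, K.C k ⬝ᵥ K.C k ≤ γ) → ∀ k f,
      quadForm (obsGram A K.C k i) (K.Z (k + i) *ᵥ f) ≤ κ * quadForm (K.Z (k + i)) f := by
  induction i with
  | zero => exact ⟨0, le_rfl, fun _ _ _ _ _ _ _ => by simp [obsGram, quadForm]⟩
  | succ i ih =>
    obtain ⟨κ, hκ, h⟩ := ih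
    obtain ⟨o, ho, hO⟩ := exists_quadForm_obsGram_le A hγ i
    obtain ⟨b, hb, hB⟩ := exists_mulVec_sq_le (A⁻¹ * B)
    refine ⟨rhi + (2 * κ + 2 * (o * (b * qhi))), by positivity, ?_⟩
    intro Q Z₀ K hK hQ hR hC k f
    set V := quadForm (K.Z (k + i + 1)) f
    set x := K.Z (k + i) *ᵥ K.dualStep (k + i) f
    set w := Q *ᵥ (Bᵀ *ᵥ K.dualUpdate (k + i) f)
    have h_state : A⁻¹ *ᵥ (K.Z (k + i + 1) *ᵥ f) = x + (A⁻¹ * B) *ᵥ w := by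
      rw [Z_succ_mulVec hK, mulVec_add, mulVec_mulVec,
        nonsing_inv_mul _ ((isUnit_iff_isUnit_det _).1 hA), one_mulVec, mulVec_mulVec w A⁻¹ B]
    have h_past : quadForm (obsGram A K.C k i) x ≤ κ * V :=
      (h K hK hQ hR hC k _).trans (by gcongr; exact quadForm_dualStep_le hK (k + i) f)
    have h_input : quadForm (obsGram A K.C k i) ((A⁻¹ * B) *ᵥ w) ≤ o * (b * (qhi * V)) := by
      refine (hO K.C hC k _).trans ?_
      gcongr
      exact (hB w).trans (by gcongr; exact smoothedInput_sq_le hK hqhi hQ (k + i) f)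
    calc quadForm (obsGram A K.C k (i + 1)) (K.Z (k + i + 1) *ᵥ f)
        = (K.C (k + i + 1) ⬝ᵥ (K.Z (k + i + 1) *ᵥ f)) ^ 2
            + quadForm (obsGram A K.C k i) (x + (A⁻¹ * B) *ᵥ w) := by
          rw [quadForm_obsGram_succ, h_state]
      _ ≤ rhi * V + (2 * (κ * V) + 2 * (o * (b * (qhi * V)))) := by
          gcongr
          · exact C_dotProduct_Z_succ_mulVec_sq_le hK hR (k + i) f
          · exact (quadForm_add_le (obsGram_posSemidef k i) _ _).trans (by gcongr)
      _ = (rhi + (2 * κ + 2 * (o * (b * qhi)))) * V := by ring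

lemma exists_Z_le_of_observable [DecidableEq m] (hA : IsUnit A) {qhi rhi γ c : ℝ}
    (hqhi : 0 < qhi) (hrhi : 0 < rhi) (hγ : 0 ≤ γ) (hc : 0 < c) (i : ℕ) :
    ∃ z : ℝ, 0 < z ∧ ∀ {Q : Matrix m m ℝ} {Z₀ : Matrix n n ℝ} (K : KalmanFilter A B Q Z₀),
      K.Admissible → Q ≤ qhi • 1 → (∀ k, K.R k ≤ rhi) → (∀ k, K.C k ⬝ᵥ K.C k ≤ γ) → ∀ k,
      c • 1 ≤ obsGram A K.C k i → K.Z (k + i) ≤ z • 1 := by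
  obtain ⟨κ, hκ, h⟩ := exists_quadForm_obsGram_Z_mulVec_le A hA B hqhi hrhi hγ i
  have hz : 0 < (κ + 1) / c := by positivity
  refine ⟨(κ + 1) / c, hz, fun K hK hQ hR hC k hO => ?_⟩
  refine le_smul_one_of_mulVec_sq_le (Z_posSemidef hK _).isHermitian hz fun f => ?_
  have h_nonneg := quadForm_nonneg (Z_posSemidef hK (k + i)) f
  rw [div_mul_eq_mul_div, le_div_iff₀' hc]
  calc c * ((K.Z (k + i) *ᵥ f) ⬝ᵥ (K.Z (k + i) *ᵥ f))
      ≤ quadForm (obsGram A K.C k i) (K.Z (k + i) *ᵥ f) := le_quadForm_of_smul_one_le hO _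
    _ ≤ κ * quadForm (K.Z (k + i)) f := h K hK hQ hR hC k f
    _ ≤ (κ + 1) * quadForm (K.Z (k + i)) f := by gcongr; exact le_add_of_nonneg_right one_pos.le

lemma Z_add_le_pow {κ z : ℝ} (hK : K.Admissible) (hκ : predCov A B Q 1 ≤ κ • 1) (hκ₁ : 1 ≤ κ)
    (hz : 1 ≤ z) {k : ℕ} (h : K.Z k ≤ z • 1) (i : ℕ) : K.Z (k + i) ≤ (κ ^ i * z) • 1 := by
  induction i with
  | zero => simpa using h
  | succ i ih =>
    have hz_pow : 1 ≤ κ ^ i * z := one_le_mul_of_one_le_of_one_le (one_le_pow₀ hκ₁) hz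
    calc K.Z (k + i + 1) ≤ predCov A B Q (K.Z (k + i)) :=
          kalmanUpdate_le (predCov_Z_posSemidef hK _) (hK.R_pos _)
      _ ≤ (κ * (κ ^ i * z)) • 1 :=
          predCov_le_smul_one hK.Q_posSemidef (Z_posSemidef hK _) hκ hz_pow ih
      _ = (κ ^ (i + 1) * z) • 1 := by rw [pow_succ', mul_assoc]

lemma exists_Z_le_of_frequently_observable [DecidableEq m] (hA : IsUnit A) {qhi rhi γ c : ℝ}
    (hqhi : 0 < qhi) (hrhi : 0 < rhi) (hγ : 0 ≤ γ) (hc : 0 < c) (hQ_psd : Q.PosSemidef)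
    (hZ₀ : Z₀.PosSemidef) (hQ : Q ≤ qhi • 1) (i l : ℕ) :
    ∃ z : ℝ, 0 < z ∧ ∀ K : KalmanFilter A B Q Z₀, (∀ k, 0 < K.R k) → (∀ k, K.R k ≤ rhi) →
      (∀ k, K.C k ⬝ᵥ K.C k ≤ γ) →
      (∀ k > l, ∃ k₁, k₁ + i ≤ k ∧ k ≤ k₁ + i + l ∧ c • 1 ≤ obsGram A K.C k₁ i) →
      ∀ k, K.Z k ≤ z • 1 := by
  obtain ⟨z₀, hz₀, hZ₀_le⟩ := exists_le_smul_one hZ₀.isHermitian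
  obtain ⟨κ, hκ₁, hκ⟩ := exists_le_smul_one
    (predCov_posSemidef (A := A) (B := B) hQ_psd (PosSemidef.one (n := n))).isHermitian
  obtain ⟨z₁, -, hz₁⟩ := exists_Z_le_of_observable (B := B) hA hqhi hrhi hγ hc i
  have hz : 1 ≤ max z₀ z₁ := hz₀.trans (le_max_left _ _)
  have h_pow {j : ℕ} (hj : j ≤ l) : κ ^ j * max z₀ z₁ ≤ κ ^ l * max z₀ z₁ := by gcongr
  refine ⟨κ ^ l * max z₀ z₁, by positivity, fun K hR_pos hR hC hO k => ?_⟩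
  have hK : K.Admissible := ⟨hQ_psd, hZ₀, hR_pos⟩
  rcases le_or_gt k l with hk | hk
  · have h_start : K.Z 0 ≤ max z₀ z₁ • 1 := hZ₀_le.trans (smul_one_mono (le_max_left _ _))
    rw [← Nat.zero_add k]
    exact (Z_add_le_pow hK hκ hκ₁ hz h_start k).trans (smul_one_mono (h_pow hk))
  · obtain ⟨k₁, h_start, h_end, h_obs⟩ := hO k hk
    obtain ⟨j, rfl⟩ := Nat.exists_eq_add_of_le h_start
    have h_window := (hz₁ K hK hQ hR hC k₁ h_obs).trans (smul_one_mono (le_max_right z₀ z₁))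
    exact (Z_add_le_pow hK hκ hκ₁ hz h_window j).trans (smul_one_mono (h_pow (by omega)))

end UpperBound

section EstimationError

variable {e : ℕ → n → ℝ} {w : ℕ → m → ℝ} {b : ℕ → ℝ} {qlo rlo : ℝ}

/-- `e` is a sequence of estimation errors of the filter `K`, for the input noise `w` and the
output noise `b`. -/
def IsError (K : KalmanFilter A B Q Z₀) (e : ℕ → n → ℝ) (w : ℕ → m → ℝ) (b : ℕ → ℝ) : Prop :=
  ∀ k, e (k + 1) = A *ᵥ e k + B *ᵥ w k
    - (K.C (k + 1) ⬝ᵥ (A *ᵥ e k + B *ᵥ w k) + b (k + 1)) • K.gain k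

/-- The normalized size of the noises that enter the step from `k` to `k + 1`. -/
def noiseSize (qlo rlo : ℝ) (w : ℕ → m → ℝ) (b : ℕ → ℝ) (k : ℕ) : ℝ :=
  (w k ⬝ᵥ w k) / qlo + b (k + 1) ^ 2 / rlo

lemma noiseSize_nonneg (hqlo : 0 < qlo) (hrlo : 0 < rlo) (k : ℕ) : 0 ≤ noiseSize qlo rlo w b k :=
  add_nonneg (div_nonneg (dotProduct_self_nonneg _) hqlo.le) (div_nonneg (sq_nonneg _) hrlo.le)

lemma IsError.dotProduct_succ (he : K.IsError e w b) (k : ℕ) (f : n → ℝ) :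
    f ⬝ᵥ e (k + 1) = K.dualStep k f ⬝ᵥ e k
      + ((Bᵀ *ᵥ K.dualUpdate k f) ⬝ᵥ w k + -(b (k + 1) * (K.gain k ⬝ᵥ f))) := by
  set x := A *ᵥ e k + B *ᵥ w k with hx
  have h_dual : K.dualUpdate k f ⬝ᵥ x
      = K.dualStep k f ⬝ᵥ e k + (Bᵀ *ᵥ K.dualUpdate k f) ⬝ᵥ w k := by
    rw [hx, dotProduct_add, dotProduct_mulVec, dotProduct_mulVec, dualStep, mulVec_transpose,
      mulVec_transpose]
  have h_update : K.dualUpdate k f ⬝ᵥ x = f ⬝ᵥ x - (K.gain k ⬝ᵥ f) * (K.C (k + 1) ⬝ᵥ x) := by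
    rw [← smul_eq_mul, ← smul_dotProduct, ← sub_dotProduct]
    rfl
  rw [he k, ← hx, dotProduct_sub, dotProduct_smul, smul_eq_mul, dotProduct_comm f (K.gain k)]
  linear_combination h_dual - h_update

variable [DecidableEq m]

lemma IsError.increment_sq_le (he : K.IsError e w b) (hK : K.Admissible) (hqlo : 0 < qlo)
    (hQ : qlo • 1 ≤ Q) (hrlo : 0 < rlo) {k : ℕ} (hR : rlo ≤ K.R (k + 1)) (f : n → ℝ) :
    (f ⬝ᵥ e (k + 1) - K.dualStep k f ⬝ᵥ e k) ^ 2
      ≤ noiseSize qlo rlo w b k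
        * (quadForm (K.Z (k + 1)) f - quadForm (K.Z k) (K.dualStep k f)) := by
  set y := Bᵀ *ᵥ K.dualUpdate k f
  set κ := K.gain k ⬝ᵥ f
  have h_input : (y ⬝ᵥ w k) ^ 2 ≤ (w k ⬝ᵥ w k) / qlo * (qlo * (y ⬝ᵥ y)) := by
    refine (dotProduct_sq_le _ _).trans_eq ?_
    field_simp
  have h_output : (-(b (k + 1) * κ)) ^ 2 ≤ b (k + 1) ^ 2 / rlo * (rlo * κ ^ 2) := by
    apply le_of_eq
    field_simp
  have h_y := dotProduct_self_nonneg y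
  have h_w := dotProduct_self_nonneg (w k)
  have h_Q := le_quadForm_of_smul_one_le hQ y
  calc (f ⬝ᵥ e (k + 1) - K.dualStep k f ⬝ᵥ e k) ^ 2
      = (y ⬝ᵥ w k + -(b (k + 1) * κ)) ^ 2 := by rw [he.dotProduct_succ, add_sub_cancel_left]
    _ ≤ noiseSize qlo rlo w b k * (qlo * (y ⬝ᵥ y) + rlo * κ ^ 2) :=
        add_sq_le_add_mul_add (by positivity) (by positivity) (by positivity) (by positivity)
          h_input h_output
    _ ≤ noiseSize qlo rlo w b k * (quadForm Q y + K.R (k + 1) * κ ^ 2) := by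
        have := noiseSize_nonneg (w := w) (b := b) hqlo hrlo k
        gcongr
    _ = _ := by
        rw [quadForm_Z_succ hK]
        ring

lemma IsError.increment_add_sq_le (he : K.IsError e w b) (hK : K.Admissible) (hqlo : 0 < qlo)
    (hQ : qlo • 1 ≤ Q) (hrlo : 0 < rlo) (hR : ∀ k, rlo ≤ K.R k) (k i : ℕ) (f : n → ℝ) :
    (f ⬝ᵥ e (k + i) - K.dualFlow i k f ⬝ᵥ e k) ^ 2
      ≤ (∑ l ∈ Finset.range i, noiseSize qlo rlo w b (k + l))
        * (quadForm (K.Z (k + i)) f - quadForm (K.Z k) (K.dualFlow i k f)) := by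
  induction i generalizing f with
  | zero => simp [dualFlow]
  | succ i ih =>
    have h := add_sq_le_add_mul_add
      (Finset.sum_nonneg fun l _ => noiseSize_nonneg (w := w) (b := b) hqlo hrlo (k + l))
      (noiseSize_nonneg hqlo hrlo (k + i))
      (sub_nonneg.2 (quadForm_dualFlow_le hK k i (K.dualStep (k + i) f)))
      (sub_nonneg.2 (quadForm_dualStep_le hK (k + i) f))
      (ih (K.dualStep (k + i) f)) (he.increment_sq_le hK hqlo hQ hrlo (hR _) f)
    rw [← Finset.sum_range_succ (fun l => noiseSize qlo rlo w b (k + l))] at h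
    convert h using 1
    · rw [dualFlow, ← Nat.add_assoc]
      ring
    · rw [dualFlow, ← Nat.add_assoc]
      ring

lemma IsError.errorBound_add (he : K.IsError e w b) (hK : K.Admissible) (hqlo : 0 < qlo)
    (hQ : qlo • 1 ≤ Q) (hrlo : 0 < rlo) (hR : ∀ k, rlo ≤ K.R k) {k : ℕ} {v : ℝ} (hv : 0 ≤ v)
    (h : ErrorBound (K.Z k) (e k) v) (i : ℕ) :
    ErrorBound (K.Z (k + i)) (e (k + i))
      (v + ∑ l ∈ Finset.range i, noiseSize qlo rlo w b (k + l)) := fun f => by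
  have h_add := add_sq_le_add_mul_add hv
    (Finset.sum_nonneg fun l _ => noiseSize_nonneg (w := w) (b := b) hqlo hrlo (k + l))
    (quadForm_nonneg (Z_posSemidef hK k) _) (sub_nonneg.2 (quadForm_dualFlow_le hK k i f))
    (h (K.dualFlow i k f)) (he.increment_add_sq_le hK hqlo hQ hrlo hR k i f)
  rwa [add_sub_cancel, add_sub_cancel] at h_add

-- Every `i` steps the dual flow loses a fixed part `1 / T` of the form `quadForm (Z _) f`.
lemma IsError.errorBound_contract (he : K.IsError e w b) (hK : K.Admissible) (hqlo : 0 < qlo)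
    (hQ : qlo • 1 ≤ Q) (hrlo : 0 < rlo) (hR : ∀ k, rlo ≤ K.R k) {T : ℝ} (hT : 0 < T) {k i : ℕ}
    (h_drop : ∀ f, quadForm (K.Z (k + i)) f
      ≤ T * (quadForm (K.Z (k + i)) f - quadForm (K.Z k) (K.dualFlow i k f)))
    {v : ℝ} (hv : 0 ≤ v) (h : ErrorBound (K.Z k) (e k) v) :
    ErrorBound (K.Z (k + i)) (e (k + i)) ((2 * T + 1) / (2 * T + 2) * v
      + (1 + 2 * T) * ∑ l ∈ Finset.range i, noiseSize qlo rlo w b (k + l)) := fun f => by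
  set ν := ∑ l ∈ Finset.range i, noiseSize qlo rlo w b (k + l)
  set V := quadForm (K.Z (k + i)) f
  set V₀ := quadForm (K.Z k) (K.dualFlow i k f) with hV₀
  set y := K.dualFlow i k f ⬝ᵥ e k
  have hν : 0 ≤ ν := Finset.sum_nonneg fun l _ => noiseSize_nonneg hqlo hrlo _
  have hV₀_nonneg : 0 ≤ V₀ := quadForm_nonneg (Z_posSemidef hK k) _
  have h_decay : V₀ ≤ T / (1 + T) * V := by
    rw [div_mul_eq_mul_div, le_div_iff₀' (by positivity)]
    linarith [h_drop f, quadForm_dualFlow_le hK k i f]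
  have h_past : y ^ 2 ≤ v * (T / (1 + T) * V) := (h _).trans (by rw [← hV₀]; gcongr)
  have h_noise : (f ⬝ᵥ e (k + i) - y) ^ 2 ≤ ν * V :=
    (he.increment_add_sq_le hK hqlo hQ hrlo hR k i f).trans (by gcongr; linarith)
  calc (f ⬝ᵥ e (k + i)) ^ 2 = (y + (f ⬝ᵥ e (k + i) - y)) ^ 2 := by rw [add_sub_cancel]
    _ ≤ (1 + 1 / (2 * T)) * y ^ 2 + (1 + 2 * T) * (f ⬝ᵥ e (k + i) - y) ^ 2 :=
        add_sq_le_one_add_mul hT _ _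
    _ ≤ (1 + 1 / (2 * T)) * (v * (T / (1 + T) * V)) + (1 + 2 * T) * (ν * V) := by gcongr
    _ = ((2 * T + 1) / (2 * T + 2) * v + (1 + 2 * T) * ν) * V := by
        field_simp
        ring

lemma IsError.errorBound_majorant (he : K.IsError e w b) (hK : K.Admissible) (hqlo : 0 < qlo)
    (hQ : qlo • 1 ≤ Q) (hrlo : 0 < rlo) (hR : ∀ k, rlo ≤ K.R k) {T r D v : ℝ} (hT : 0 < T)
    {i : ℕ} (hi : 0 < i) (h_drop : ∀ k f, quadForm (K.Z (k + i)) f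
      ≤ T * (quadForm (K.Z (k + i)) f - quadForm (K.Z k) (K.dualFlow i k f)))
    (hr : 0 ≤ r) (hr₁ : r ≤ 1) (hrT : (2 * T + 1) / (2 * T + 2) ≤ r ^ i)
    (hD : 1 + 2 * T ≤ r ^ i * D) (hv : 0 ≤ v) (h₀ : ErrorBound (K.Z 0) (e 0) v) (k : ℕ) :
    ErrorBound (K.Z k) (e k) (majorant r D v (noiseSize qlo rlo w b) k) := by
  have hν := noiseSize_nonneg (w := w) (b := b) hqlo hrlo
  have hD_nonneg : 0 ≤ D := by
    by_contra! h
    nlinarith [pow_nonneg hr i]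
  induction k using Nat.strong_induction_on with
  | _ k ih =>
  rcases lt_or_ge k i with hk | hk
  · have h_grow := (he.errorBound_add hK hqlo hQ hrlo hR hv h₀ k).mono (Z_posSemidef hK _)
      (le_trans ?_ (le_majorant_add (v := v) hr hr₁ hD_nonneg hν 0 k))
    · rwa [Nat.zero_add] at h_grow
    · have h_sum := Finset.sum_nonneg fun l (_ : l ∈ Finset.range k) => hν (0 + l)
      have hD_one : 1 ≤ r ^ k * D :=
        calc 1 ≤ 1 + 2 * T := by linarith
          _ ≤ r ^ i * D := hD
          _ ≤ r ^ k * D := by gcongr ?_ * D; exact pow_le_pow_of_le_one hr hr₁ hk.le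
      rw [majorant, ← mul_add, ← mul_assoc]
      exact le_mul_of_one_le_left (add_nonneg hv h_sum) hD_one
  · obtain ⟨k, rfl⟩ := Nat.exists_eq_add_of_le' hk
    have hM := majorant_nonneg hr hD_nonneg hv hν k
    refine (he.errorBound_contract hK hqlo hQ hrlo hR hT (h_drop k) hM (ih k (by omega))).mono
      (Z_posSemidef hK _) (le_trans ?_ (le_majorant_add hr hr₁ hD_nonneg hν k i))
    rw [mul_add, ← mul_assoc]
    gcongr
    exact Finset.sum_nonneg fun l _ => hν _

lemma exists_dotProduct_self_le_majorant {i : ℕ} (hi : 0 < i) (hAB : (ctrlGram A B i).PosDef)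
    (hqlo : 0 < qlo) (hQ : qlo • 1 ≤ Q) (hrlo : 0 < rlo) {γ : ℝ} (hγ : 0 ≤ γ) {z₀ z : ℝ}
    (hz₀ : 0 < z₀) (hZ₀ : z₀ • 1 ≤ Z₀) (hz : 0 < z) :
    ∃ r D : ℝ, 0 ≤ r ∧ r < 1 ∧ 0 ≤ D ∧ ∀ {K : KalmanFilter A B Q Z₀} {e : ℕ → n → ℝ}
      {w : ℕ → m → ℝ} {b : ℕ → ℝ}, K.IsError e w b → (∀ k, rlo ≤ K.R k) →
      (∀ k, K.C k ⬝ᵥ K.C k ≤ γ) → (∀ k, K.Z k ≤ z • 1) → ∀ k,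
      e k ⬝ᵥ e k ≤ z * majorant r D ((e 0 ⬝ᵥ e 0) / z₀) (noiseSize qlo rlo w b) k := by
  obtain ⟨L, hL, h_drop⟩ := exists_dotProduct_self_le_decrement hAB hqlo hrlo hγ
  set T := z * L with hT_def
  have hT : 0 < T := mul_pos hz hL
  obtain ⟨r, hr, hr₁, hrT⟩ := exists_le_pow (l := (2 * T + 1) / (2 * T + 2)) (by positivity)
    ((div_lt_one (by positivity)).2 (by linarith)) i
  refine ⟨r, (1 + 2 * T) / r ^ i, hr.le, hr₁, by positivity, fun {K e w b} he hR hC hZ k => ?_⟩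
  have hK := admissible_of_le hqlo hQ (posDef_of_smul_one_le hz₀ hZ₀).posSemidef hrlo hR
  have hv : 0 ≤ (e 0 ⬝ᵥ e 0) / z₀ := div_nonneg (dotProduct_self_nonneg _) hz₀.le
  have h_contract : ∀ k f, quadForm (K.Z (k + i)) f
      ≤ T * (quadForm (K.Z (k + i)) f - quadForm (K.Z k) (K.dualFlow i k f)) := fun k f =>
    calc quadForm (K.Z (k + i)) f ≤ z * (f ⬝ᵥ f) := quadForm_le_of_le_smul_one (hZ _) f
      _ ≤ T * _ := by
        rw [hT_def, mul_assoc]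
        exact mul_le_mul_of_nonneg_left (h_drop K hK hQ hR hC k f) hz.le
  exact (he.errorBound_majorant hK hqlo hQ hrlo hR hT hi h_contract hr.le hr₁.le hrT
    (mul_div_cancel₀ _ (by positivity)).ge hv
    (errorBound_of_smul_one_le hz₀ hZ₀ (e 0)) k).dotProduct_self_le
      (majorant_nonneg hr.le (by positivity) hv (noiseSize_nonneg hqlo hrlo) k) hz (hZ k)

end EstimationError

end KalmanFilter

section DoubleIntegrator

variable {t : ℝ}

lemma dotProduct_SIdx (x y : SIdx → ℝ) :
    x ⬝ᵥ y = (x (.inl 0) * y (.inl 0) + x (.inl 1) * y (.inl 1))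
      + (x (.inr 0) * y (.inr 0) + x (.inr 1) * y (.inr 1)) := by
  simp only [dotProduct, Fintype.sum_sum_type, Fin.sum_univ_two]

lemma A₂_mulVec (x : SIdx → ℝ) :
    A₂ t *ᵥ x = Sum.elim (fun a => x (.inl a) + t * x (.inr a)) (fun a => x (.inr a)) := by
  ext (a | a) <;> simp [A₂, fromBlocks_mulVec, Function.comp_def, smul_mulVec]

lemma A₂_transpose_mulVec (f : SIdx → ℝ) :
    (A₂ t)ᵀ *ᵥ f = Sum.elim (fun a => f (.inl a)) (fun a => t * f (.inl a) + f (.inr a)) := by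
  ext (a | a) <;>
    simp [A₂, fromBlocks_transpose, fromBlocks_mulVec, Function.comp_def, smul_mulVec]

lemma B₂_transpose_mulVec (f : SIdx → ℝ) :
    (B₂ t)ᵀ *ᵥ f = fun a => t ^ 2 / 2 * f (.inl a) + t * f (.inr a) := by
  ext a
  simp [B₂, transpose_fromRows, fromCols_mulVec, Function.comp_def, smul_mulVec]

lemma A₂_mul_neg (t : ℝ) : A₂ t * A₂ (-t) = 1 := by
  simp [A₂, fromBlocks_multiply]

lemma isUnit_A₂ (t : ℝ) : IsUnit (A₂ t) :=
  .of_mul_eq_one _ (A₂_mul_neg t)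

lemma inv_A₂ (t : ℝ) : (A₂ t)⁻¹ = A₂ (-t) :=
  inv_eq_right_inv (A₂_mul_neg t)

lemma ctrlGram_two_posDef (ht : t ≠ 0) : (ctrlGram (A₂ t) (B₂ t) 2).PosDef := by
  refine PosDef.of_dotProduct_mulVec_pos (ctrlGram_posSemidef _ _ 2).isHermitian fun f hf => ?_
  have h_nonneg := fun g : SIdx → ℝ => dotProduct_self_nonneg ((B₂ t)ᵀ *ᵥ g)
  rw [star_trivial, ← quadForm, quadForm_ctrlGram_succ, quadForm_ctrlGram_succ]
  simp only [ctrlGram, quadForm, zero_mulVec, dotProduct_zero, zero_add]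
  refine lt_of_le_of_ne (add_nonneg (h_nonneg _) (h_nonneg _)) fun h_zero => hf ?_
  obtain ⟨h_first, h_second⟩ :=
    (add_eq_zero_iff_of_nonneg (h_nonneg ((A₂ t)ᵀ *ᵥ f)) (h_nonneg f)).1 h_zero.symm
  rw [dotProduct_self_eq_zero, A₂_transpose_mulVec, B₂_transpose_mulVec] at h_first
  rw [dotProduct_self_eq_zero, B₂_transpose_mulVec] at h_second
  have h_inl (a : Fin 2) : f (.inl a) = 0 := by
    have h₁ := congrFun h_first a
    have h₂ := congrFun h_second a
    simp only [Sum.elim_inl, Sum.elim_inr, Pi.zero_apply] at h₁ h₂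
    have h_diff : t ^ 2 * f (.inl a) = 0 := by linear_combination h₁ - h₂
    simpa [ht] using h_diff
  ext (a | a)
  · exact h_inl a
  · simpa [h_inl, ht] using congrFun h_second a

end DoubleIntegrator

section RotatingOutput

/-- The component of `y` along the unit vector `(sin ψ, cos ψ)`; the two drones around a target
measure it for the direction `ψ` that joins them. -/
def bearing (ψ : ℝ) (y : Fin 2 → ℝ) : ℝ := Real.sin ψ * y 0 + Real.cos ψ * y 1

lemma bearing_sub (ψ : ℝ) (x y : Fin 2 → ℝ) : bearing ψ (x - y) = bearing ψ x - bearing ψ y := by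
  simp only [bearing, Pi.sub_apply]
  ring

lemma bearing_sq_le (ψ : ℝ) (y : Fin 2 → ℝ) : bearing ψ y ^ 2 ≤ y ⬝ᵥ y := by
  rw [bearing, dotProduct, Fin.sum_univ_two]
  nlinarith [sq_nonneg (Real.cos ψ * y 0 - Real.sin ψ * y 1), Real.sin_sq_add_cos_sq ψ]

lemma sin_sq_mul_dotProduct_self_le (ψ α : ℝ) (y : Fin 2 → ℝ) :
    Real.sin α ^ 2 * (y ⬝ᵥ y) ≤ 2 * (bearing ψ y ^ 2 + bearing (ψ - α) y ^ 2) := by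
  have h_id : Real.sin α ^ 2 * (y ⬝ᵥ y) = bearing ψ y ^ 2 + bearing (ψ - α) y ^ 2
      - 2 * Real.cos α * (bearing ψ y * bearing (ψ - α) y) := by
    rw [bearing, bearing, dotProduct, Fin.sum_univ_two, Real.sin_sub, Real.cos_sub]
    linear_combination
      (-Real.sin α ^ 2 * (y 0 * y 0 + y 1 * y 1)) * Real.sin_sq_add_cos_sq ψ
        + (Real.sin ψ * y 0 + Real.cos ψ * y 1) ^ 2 * Real.sin_sq_add_cos_sq α
  nlinarith [sq_nonneg (bearing ψ y + Real.cos α * bearing (ψ - α) y), Real.cos_sq_le_one α,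
    sq_nonneg (bearing (ψ - α) y)]

-- The positions `X + V, X, X - V` seen from rotating directions: the second difference twisted by
-- the rotation removes `X`.
lemma twisted_second_difference (ψ α : ℝ) (X V : Fin 2 → ℝ) :
    bearing (ψ + α) (X + V) - 2 * Real.cos α * bearing ψ X + bearing (ψ - α) (X - V)
      = 2 * Real.sin α * bearing (ψ + Real.pi / 2) V := by
  simp only [bearing, Pi.add_apply, Pi.sub_apply, Real.sin_add, Real.cos_add, Real.sin_sub,
    Real.cos_sub, Real.sin_pi_div_two, Real.cos_pi_div_two]
  ring

lemma sin_sq_mul_bearing_sq_le (ψ α : ℝ) (X V : Fin 2 → ℝ) :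
    2 * (Real.sin α ^ 2 * bearing (ψ + Real.pi / 2) V ^ 2)
      ≤ 3 * (bearing (ψ + α) (X + V) ^ 2 + bearing ψ X ^ 2 + bearing (ψ - α) (X - V) ^ 2) := by
  have h := twisted_second_difference ψ α X V
  set a := bearing (ψ + α) (X + V)
  set b := bearing ψ X
  set d := bearing (ψ - α) (X - V)
  have h_cos : (Real.cos α * b) ^ 2 ≤ b ^ 2 := by
    rw [mul_pow]
    exact mul_le_of_le_one_left (sq_nonneg b) (Real.cos_sq_le_one α)
  have h_sq : 4 * (Real.sin α ^ 2 * bearing (ψ + Real.pi / 2) V ^ 2)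
      = (a - 2 * (Real.cos α * b) + d) ^ 2 := by
    linear_combination
      (-(a - 2 * (Real.cos α * b) + d) - 2 * Real.sin α * bearing (ψ + Real.pi / 2) V) * h
  nlinarith [sq_nonneg (2 * a + Real.cos α * b), sq_nonneg (a - d),
    sq_nonneg (Real.cos α * b + 2 * d)]

variable {φ α : ℝ} {P V : Fin 2 → ℝ}

/-- The energy of the four bearings of a point that moves back from `P` at velocity `V`, while
the direction turns back from `φ` by `α` per step. -/
def bearingEnergy (φ α : ℝ) (P V : Fin 2 → ℝ) : ℝ :=
  ∑ i ∈ Finset.range 4, bearing (φ - i * α) (P - (i : ℝ) • V) ^ 2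

lemma bearingEnergy_eq :
    bearingEnergy φ α P V = bearing φ P ^ 2 + bearing (φ - α) (P - V) ^ 2
      + bearing (φ - 2 * α) (P - (2 : ℝ) • V) ^ 2
      + bearing (φ - 3 * α) (P - (3 : ℝ) • V) ^ 2 := by
  simp [bearingEnergy, Finset.sum_range_succ]

lemma velocity_sq_le_bearingEnergy (hα : 0 < Real.sin α) :
    V ⬝ᵥ V ≤ 6 / Real.sin α ^ 4 * bearingEnergy φ α P V := by
  have h₁ := sin_sq_mul_bearing_sq_le (φ - α) α (P - V) V
  have h₂ := sin_sq_mul_bearing_sq_le (φ - 2 * α) α (P - (2 : ℝ) • V) V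
  have h_span := sin_sq_mul_dotProduct_self_le (φ - α + Real.pi / 2) α V
  rw [show φ - α + α = φ by ring, show P - V + V = P by abel, show φ - α - α = φ - 2 * α by ring,
    show P - V - V = P - (2 : ℝ) • V by rw [two_smul]; abel] at h₁
  rw [show φ - 2 * α + α = φ - α by ring, show P - (2 : ℝ) • V + V = P - V by rw [two_smul]; abel,
    show φ - 2 * α - α = φ - 3 * α by ring,
    show P - (2 : ℝ) • V - V = P - (3 : ℝ) • V by module] at h₂
  rw [show φ - α + Real.pi / 2 - α = φ - 2 * α + Real.pi / 2 by ring] at h_span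
  rw [div_mul_eq_mul_div, le_div_iff₀' (by positivity)]
  rw [bearingEnergy_eq]
  nlinarith [mul_le_mul_of_nonneg_left h_span (sq_nonneg (Real.sin α)),
    sq_nonneg (bearing φ P), sq_nonneg (bearing (φ - 3 * α) (P - (3 : ℝ) • V))]

lemma position_sq_le_bearingEnergy (hα : 0 < Real.sin α) :
    P ⬝ᵥ P ≤ (4 / Real.sin α ^ 2 + 24 / Real.sin α ^ 6) * bearingEnergy φ α P V := by
  have h_velocity := velocity_sq_le_bearingEnergy (φ := φ) (P := P) (V := V) hα
  have h_span := sin_sq_mul_dotProduct_self_le φ α P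
  have h_drift := bearing_sq_le (φ - α) V
  have h_energy : bearing φ P ^ 2 + bearing (φ - α) (P - V) ^ 2 ≤ bearingEnergy φ α P V := by
    rw [bearingEnergy_eq]
    nlinarith [sq_nonneg (bearing (φ - 2 * α) (P - (2 : ℝ) • V)),
      sq_nonneg (bearing (φ - 3 * α) (P - (3 : ℝ) • V))]
  rw [bearing_sub] at h_energy
  have h_bound : Real.sin α ^ 2 * (P ⬝ᵥ P)
      ≤ 4 * bearingEnergy φ α P V + 4 * (V ⬝ᵥ V) := by
    nlinarith [sq_nonneg (bearing (φ - α) P - 2 * bearing (φ - α) V), sq_nonneg (bearing φ P)]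
  calc P ⬝ᵥ P ≤ (4 * bearingEnergy φ α P V + 4 * (V ⬝ᵥ V)) / Real.sin α ^ 2 := by
        rwa [le_div_iff₀' (by positivity)]
    _ ≤ (4 * bearingEnergy φ α P V + 4 * (6 / Real.sin α ^ 4 * bearingEnergy φ α P V))
          / Real.sin α ^ 2 := by gcongr
    _ = _ := by field_simp; ring

lemma quadForm_obsGram_of_bearing {t r : ℝ} {C : ℕ → SIdx → ℝ} {k : ℕ}
    (hC : ∀ i ≤ 3, ∀ y, C (k + i + 1) ⬝ᵥ y = r * bearing (φ + i * α) (fun a => y (.inl a)))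
    (x : SIdx → ℝ) :
    quadForm (obsGram (A₂ t) C k 4) x = r ^ 2 * bearingEnergy (φ + 3 * α) α
      (fun a => x (.inl a)) (t • fun a => x (.inr a)) := by
  simp only [quadForm_obsGram_succ, inv_A₂, A₂_mulVec, bearingEnergy_eq]
  rw [hC 3 le_rfl, hC 2 (by norm_num), hC 1 (by norm_num), hC 0 (by norm_num)]
  simp only [obsGram, quadForm, zero_mulVec, dotProduct_zero, bearing, Sum.elim_inl, Sum.elim_inr,
    Pi.sub_apply, Pi.smul_apply, smul_eq_mul]
  push_cast
  ring_nf

lemma exists_smul_one_le_obsGram_of_bearing {t r α : ℝ} (ht : t ≠ 0) (hr : r ≠ 0)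
    (hα : 0 < Real.sin α) :
    ∃ c : ℝ, 0 < c ∧ ∀ (C : ℕ → SIdx → ℝ) (k : ℕ) (φ : ℝ),
      (∀ i ≤ 3, ∀ y, C (k + i + 1) ⬝ᵥ y = r * bearing (φ + i * α) (fun a => y (.inl a))) →
      c • 1 ≤ obsGram (A₂ t) C k 4 := by
  set κ := 4 / Real.sin α ^ 2 + 24 / Real.sin α ^ 6 + 6 / Real.sin α ^ 4 / t ^ 2 with hκ
  have hκ_pos : 0 < κ := by positivity
  refine ⟨r ^ 2 / κ, by positivity, fun C k φ hC => ?_⟩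
  refine smul_one_le_of_le_quadForm (obsGram_posSemidef k 4).isHermitian fun x => ?_
  rw [quadForm_obsGram_of_bearing hC, div_mul_eq_mul_div, div_le_iff₀ hκ_pos, mul_assoc]
  gcongr
  set P : Fin 2 → ℝ := fun a => x (.inl a)
  set v : Fin 2 → ℝ := fun a => x (.inr a)
  have h_position := position_sq_le_bearingEnergy (φ := φ + 3 * α) (P := P) (V := t • v) hα
  have h_velocity : v ⬝ᵥ v ≤ 6 / Real.sin α ^ 4 / t ^ 2
      * bearingEnergy (φ + 3 * α) α P (t • v) := by
    have h_scale : (t • v) ⬝ᵥ (t • v) = t ^ 2 * (v ⬝ᵥ v) := by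
      rw [smul_dotProduct, dotProduct_smul, smul_eq_mul, smul_eq_mul]
      ring
    rw [div_mul_eq_mul_div, le_div_iff₀' (by positivity), ← h_scale]
    exact velocity_sq_le_bearingEnergy hα
  calc x ⬝ᵥ x = P ⬝ᵥ P + v ⬝ᵥ v := by
        rw [dotProduct_SIdx, dotProduct, dotProduct, Fin.sum_univ_two, Fin.sum_univ_two]
    _ ≤ _ := add_le_add h_position h_velocity
    _ = _ := by rw [hκ]; ring

end RotatingOutput

section OutputRow

lemma F_mulVec (y : Fin 3 → ℝ) : F *ᵥ y = ![y 0, y 1] := by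
  ext a
  fin_cases a <;> simp [F, mulVec, dotProduct, Fin.sum_univ_three]

lemma F_mulVec_transpose_mulVec (y : Fin 2 → ℝ) : F *ᵥ (Fᵀ *ᵥ y) = y := by
  ext a
  fin_cases a <;> simp [F, mulVec, dotProduct, Fin.sum_univ_two, Fin.sum_univ_three]

lemma dotProduct_self_le_of_vecMulVec_le {n : Type*} [Fintype n] [DecidableEq n] {p : n → ℝ}
    {c : ℝ} (hc : 0 ≤ c) (h : vecMulVec p p ≤ c • 1) : p ⬝ᵥ p ≤ c := by
  have h_sq := quadForm_le_of_le_smul_one h p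
  rw [quadForm_vecMulVec_self] at h_sq
  rcases (dotProduct_self_nonneg p).eq_or_lt with hp | hp
  · rwa [← hp]
  · nlinarith

lemma outRow_dotProduct_self_le (p : Fin 3 → ℝ) : outRow p ⬝ᵥ outRow p ≤ 4 * (p ⬝ᵥ p) := by
  rw [dotProduct_SIdx, dotProduct, Fin.sum_univ_three]
  simp only [outRow, F_mulVec, Sum.elim_inl, Sum.elim_inr, Pi.smul_apply, Pi.zero_apply,
    smul_eq_mul, cons_val_zero, cons_val_one]
  nlinarith [sq_nonneg (p 2)]

end OutputRow

section Measurability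

variable {Ω : Type*} [MeasurableSpace Ω] {l m n : Type*}

lemma measurable_dotProduct [Fintype n] {u v : Ω → n → ℝ} (hu : Measurable u)
    (hv : Measurable v) : Measurable fun ω => u ω ⬝ᵥ v ω :=
  Finset.measurable_sum _ fun j _ =>
    ((measurable_pi_apply j).comp hu).mul ((measurable_pi_apply j).comp hv)

lemma measurable_mulVec [Fintype n] {A : Ω → Matrix m n ℝ} {v : Ω → n → ℝ}
    (hA : ∀ i j, Measurable fun ω => A ω i j) (hv : Measurable v) :
    Measurable fun ω => A ω *ᵥ v ω :=
  measurable_pi_lambda _ fun i => measurable_dotProduct (measurable_pi_lambda _ (hA i)) hv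

lemma measurable_const_mulVec [Fintype n] (A : Matrix m n ℝ) :
    Measurable fun v : n → ℝ => A *ᵥ v :=
  measurable_mulVec (fun _ _ => measurable_const) measurable_id

lemma measurable_matrix_mul [Fintype m] {A : Ω → Matrix l m ℝ} {B : Ω → Matrix m n ℝ}
    (hA : ∀ i j, Measurable fun ω => A ω i j) (hB : ∀ i j, Measurable fun ω => B ω i j)
    (i : l) (j : n) : Measurable fun ω => (A ω * B ω) i j :=
  Finset.measurable_sum _ fun k _ => (hA i k).mul (hB k j)

lemma measurable_predVar {t : ℝ} {Q : Matrix (Fin 2) (Fin 2) ℝ} {Z : Ω → Matrix SIdx SIdx ℝ}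
    (hZ : ∀ a b, Measurable fun ω => Z ω a b) (a b : SIdx) :
    Measurable fun ω => predVar t Q (Z ω) a b :=
  (measurable_matrix_mul (measurable_matrix_mul (A := fun _ => A₂ t) (fun _ _ => measurable_const)
    hZ) (B := fun _ => (A₂ t)ᵀ) (fun _ _ => measurable_const) a b).add_const _

lemma measurable_gain {P : Ω → Matrix SIdx SIdx ℝ} {C : Ω → SIdx → ℝ} {R : Ω → ℝ}
    (hP : ∀ a b, Measurable fun ω => P ω a b) (hC : Measurable C) (hR : Measurable R) :
    Measurable fun ω => gain (P ω) (C ω) (R ω) :=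
  ((measurable_dotProduct hC (measurable_mulVec hP hC)).add hR).inv.smul (measurable_mulVec hP hC)

end Measurability

section Expectation

variable {Ω : Type*} [MeasurableSpace Ω] {μ : Measure Ω}

lemma integral_eq_zero_of_odd [IsFiniteMeasure μ] {α β : Type*} [MeasurableSpace α] [Neg α]
    [MeasurableNeg α] [MeasurableSpace β] {E : Ω → α} {X : Ω → β} (hX : AEMeasurable X μ)
    (h_indep : IndepFun E X μ) (h_symm : IdentDistrib (fun ω => -E ω) E μ μ) {Φ : α × β → ℝ}
    (hΦ : Measurable Φ) (h_odd : ∀ a b, Φ (-a, b) = -Φ (a, b)) :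
    ∫ ω, Φ (E ω, X ω) ∂μ = 0 := by
  have h_neg_indep : IndepFun (fun ω => -E ω) X μ := h_indep.comp measurable_neg measurable_id
  have h_eq := ((h_symm.prodMk (.refl hX) h_neg_indep h_indep).comp hΦ).integral_eq
  simp only [Function.comp_apply, h_odd, integral_neg] at h_eq
  linarith

lemma integral_majorant_le {r D b : ℝ} (hr : 0 ≤ r) (hr₁ : r < 1) (hD : 0 ≤ D) (hb : 0 ≤ b)
    {v : Ω → ℝ} (hv : Integrable v μ) {ν : ℕ → Ω → ℝ}
    (hν : ∀ k, Integrable (ν k) μ ∧ ∫ ω, ν k ω ∂μ ≤ b) (k : ℕ) :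
    Integrable (fun ω => majorant r D (v ω) (fun l => ν l ω) k) μ ∧
      ∫ ω, majorant r D (v ω) (fun l => ν l ω) k ∂μ ≤ D * |∫ ω, v ω ∂μ| + D * b / (1 - r) := by
  have hr' : 0 < 1 - r := sub_pos.2 hr₁
  have hDb : 0 ≤ D * b / (1 - r) := by positivity
  have h_abs : 0 ≤ D * |∫ ω, v ω ∂μ| := by positivity
  induction k with
  | zero =>
    refine ⟨hv.const_mul D, ?_⟩
    simp only [majorant, integral_const_mul]
    nlinarith [le_abs_self (∫ ω, v ω ∂μ)]
  | succ k ih =>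
    have h_past := ih.1.const_mul r
    have h_noise := (hν k).1.const_mul D
    refine ⟨h_past.add h_noise, ?_⟩
    simp only [majorant]
    rw [integral_add h_past h_noise, integral_const_mul, integral_const_mul]
    calc r * ∫ ω, majorant r D (v ω) (fun l => ν l ω) k ∂μ + D * ∫ ω, ν k ω ∂μ
        ≤ r * (D * |∫ ω, v ω ∂μ| + D * b / (1 - r)) + D * b := by
          gcongr
          exacts [ih.2, (hν k).2]
      _ = r * (D * |∫ ω, v ω ∂μ|) + D * b / (1 - r) := by
          field_simp
          ring
      _ ≤ D * |∫ ω, v ω ∂μ| + D * b / (1 - r) := by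
          exact add_le_add_left (mul_le_of_le_one_left h_abs hr₁.le) _

end Expectation

namespace Scenario

variable {Ω : Type*} {M N : ℕ} {S : Scenario Ω M N}

/-- The estimator of target `j` along the sample path `ω`, as a Kalman filter. -/
def run (S : Scenario Ω M N) (j : Fin M) (ω : Ω) :
    KalmanFilter (A₂ S.t) (B₂ S.t) (S.Q j) (S.ζ₀ j) where
  C k := S.C j k ω
  R k := S.Υhat j k ω

/-- The centred output noise: `E (ε_i² - ε_g²) = q_i - q_g`. -/
def β (S : Scenario Ω M N) (j : Fin M) (k : ℕ) (ω : Ω) : ℝ :=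
  S.εbar j k ω - ((S.q (S.i j) : ℝ) - (S.q (S.g j) : ℝ))

lemma run_Z (j : Fin M) (k : ℕ) (ω : Ω) : (S.run j ω).Z k = S.ζ j k ω := by
  induction k with
  | zero => rfl
  | succ k ih =>
    rw [KalmanFilter.Z, ih]
    rfl

lemma run_gain (j : Fin M) (k : ℕ) (ω : Ω) : (S.run j ω).gain k = S.K j k ω := by
  rw [KalmanFilter.gain, run_Z]
  rfl

lemma C_dotProduct_self_le {j : Fin M} {k : ℕ} {ω : Ω} {c : ℝ} (hc : 0 ≤ c)
    (h : vecMulVec (S.p j k ω) (S.p j k ω) ≤ c • 1) : S.C j k ω ⬝ᵥ S.C j k ω ≤ 4 * c :=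
  (outRow_dotProduct_self_le _).trans (by linarith [dotProduct_self_le_of_vecMulVec_le hc h])

-- Taking the difference of the two squared distances cancels the quadratic term `‖s‖²`.
lemma θ_eq (j : Fin M) (k : ℕ) (ω : Ω) :
    S.θ j k ω = S.C j k ω ⬝ᵥ S.η j k ω + S.εbar j k ω := by
  have h_dist : ∀ h, S.dist h j k ω ^ 2
      = (F *ᵥ S.x h k ω - S.s j k ω) ⬝ᵥ (F *ᵥ S.x h k ω - S.s j k ω) := fun h => eNorm_sq _
  have hi := h_dist (S.i j)
  have hg := h_dist (S.g j)
  rw [θ, εbar, d, d, C, outRow, p, dotProduct_SIdx, mulVec_sub]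
  simp only [dotProduct, Fin.sum_univ_two, Pi.sub_apply, s, Sum.elim_inl, Sum.elim_inr,
    Pi.smul_apply, smul_eq_mul, Pi.zero_apply] at hi hg ⊢
  linear_combination hi - hg

variable [MeasurableSpace Ω] {μ : Measure Ω}

lemma IsModel.isError (hS : S.IsModel μ) (j : Fin M) (ω : Ω) :
    (S.run j ω).IsError (fun k => S.e j k ω) (fun k => S.acc j k ω) (fun k => S.β j k ω) := by
  intro k
  have h_prior : A₂ S.t *ᵥ S.e j k ω + B₂ S.t *ᵥ S.acc j k ω
      = S.η j (k + 1) ω - A₂ S.t *ᵥ S.ηhat j k ω := by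
    rw [hS.target, e, mulVec_sub]
    abel
  have h_innovation : S.θ j (k + 1) ω - (S.C j (k + 1) ω ⬝ᵥ (A₂ S.t *ᵥ S.ηhat j k ω)
        + (S.q (S.i j) : ℝ) - (S.q (S.g j) : ℝ))
      = S.C j (k + 1) ω ⬝ᵥ (S.η j (k + 1) ω - A₂ S.t *ᵥ S.ηhat j k ω) + S.β j (k + 1) ω := by
    rw [θ_eq, β, dotProduct_sub]
    ring
  rw [h_prior, run_gain]
  change S.η j (k + 1) ω - S.ηhat j (k + 1) ω = _
  rw [ηhat, h_innovation, sub_add_eq_sub_sub]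
  rfl

section Measurability

lemma IsModel.measurable_η (hS : S.IsModel μ) (j : Fin M) (k : ℕ) : Measurable (S.η j k) := by
  induction k with
  | zero => exact hS.meas_η₀ j
  | succ k ih =>
    rw [funext (hS.target j k)]
    exact ((measurable_const_mulVec _).comp ih).add
      ((measurable_const_mulVec _).comp (hS.meas_acc j k))

lemma measurable_planarDist :
    Measurable fun z : (Fin 3 → ℝ) × (SIdx → ℝ) => eNorm (F *ᵥ z.1 - fun a => z.2 (.inl a)) :=
  ((WithLp.measurable_toLp 2 _).comp
    (((measurable_const_mulVec F).comp measurable_fst).sub (by fun_prop))).norm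

lemma IsModel.measurable_dist (hS : S.IsModel μ) (h : Fin N) (j : Fin M) (k : ℕ) :
    Measurable (S.dist h j k) := by
  have h_comp := measurable_planarDist.comp ((hS.meas_x h k).prodMk (hS.measurable_η j k))
  exact h_comp

lemma IsModel.measurable_εbar (hS : S.IsModel μ) (j : Fin M) (k : ℕ) : Measurable (S.εbar j k) := by
  have h_dist_i := hS.measurable_dist (S.i j) j k
  have h_dist_g := hS.measurable_dist (S.g j) j k
  have h_ε_i := hS.meas_ε (S.i j) j k
  have h_ε_g := hS.meas_ε (S.g j) j k
  unfold εbar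
  fun_prop

lemma IsModel.measurable_C (hS : S.IsModel μ) (j : Fin M) (k : ℕ) : Measurable (S.C j k) := by
  have h_p : Measurable fun ω => F *ᵥ S.p j k ω :=
    (measurable_const_mulVec F).comp ((hS.meas_x _ k).sub (hS.meas_x _ k))
  refine measurable_pi_lambda _ fun a => ?_
  rcases a with a | _
  · exact ((measurable_pi_apply a).comp h_p).const_mul (-2 : ℝ)
  · exact measurable_const

lemma IsModel.measurable_θ (hS : S.IsModel μ) (j : Fin M) (k : ℕ) : Measurable (S.θ j k) := by
  rw [funext (θ_eq j k)]
  exact (measurable_dotProduct (hS.measurable_C j k) (hS.measurable_η j k)).add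
    (hS.measurable_εbar j k)

lemma IsModel.measurable_ζ (hS : S.IsModel μ) (j : Fin M) (k : ℕ) (a b : SIdx) :
    Measurable fun ω => S.ζ j k ω a b := by
  induction k generalizing a b with
  | zero => exact measurable_const
  | succ k ih =>
    have h_C := hS.measurable_C j (k + 1)
    have h_pred := measurable_predVar (t := S.t) (Q := S.Q j) ih
    have h_gain := measurable_gain h_pred h_C (hS.meas_Υhat j (k + 1))
    refine measurable_matrix_mul (fun i l => ?_) h_pred a b
    exact measurable_const.sub
      (((measurable_pi_apply i).comp h_gain).mul ((measurable_pi_apply l).comp h_C))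

lemma IsModel.measurable_K (hS : S.IsModel μ) (j : Fin M) (k : ℕ) : Measurable (S.K j k) :=
  measurable_gain (measurable_predVar (hS.measurable_ζ j k)) (hS.measurable_C j (k + 1))
    (hS.meas_Υhat j (k + 1))

lemma IsModel.measurable_ηhat (hS : S.IsModel μ) (j : Fin M) (k : ℕ) : Measurable (S.ηhat j k) := by
  induction k with
  | zero => exact hS.meas_ηhat₀ j
  | succ k ih =>
    have h_pred := (measurable_const_mulVec (A₂ S.t)).comp ih
    have h_output := measurable_dotProduct (hS.measurable_C j (k + 1)) h_pred
    exact h_pred.add (((hS.measurable_θ j (k + 1)).sub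
      ((h_output.add_const _).sub_const _)).smul (hS.measurable_K j k))

lemma IsModel.measurable_e (hS : S.IsModel μ) (j : Fin M) (k : ℕ) : Measurable (S.e j k) :=
  (hS.measurable_η j k).sub (hS.measurable_ηhat j k)

end Measurability

section Moments

lemma IsModel.integrable_ε_sq (hS : S.IsModel μ) (h : Fin N) (j : Fin M) (k : ℕ) :
    Integrable (fun ω => S.ε h j k ω ^ 2) μ :=
  (hS.ε_law h j k).hasGaussianLaw.memLp_two.integrable_sq

lemma IsModel.integral_ε_sq (hS : S.IsModel μ) (h : Fin N) (j : Fin M) (k : ℕ) :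
    ∫ ω, S.ε h j k ω ^ 2 ∂μ = S.q h := by
  have h_law := hS.ε_law h j k
  have h_mean : ∫ ω, S.ε h j k ω ∂μ = 0 := by
    rw [h_law.integral_eq, integral_id_gaussianReal]
  rw [← variance_of_integral_eq_zero h_law.aemeasurable h_mean, h_law.variance_eq,
    variance_id_gaussianReal]

lemma IsModel.identDistrib_neg_ε [IsProbabilityMeasure μ] (hS : S.IsModel μ) (j : Fin M) (k : ℕ) :
    IdentDistrib (fun ω => -(S.ε (S.i j) j k ω, S.ε (S.g j) j k ω))
      (fun ω => (S.ε (S.i j) j k ω, S.ε (S.g j) j k ω)) μ μ := by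
  have h_neg : ∀ h, IdentDistrib (fun ω => -S.ε h j k ω) (S.ε h j k) μ μ := fun h => by
    have h_law := gaussianReal_neg (hS.ε_law h j k)
    rw [neg_zero] at h_law
    exact h_law.identDistrib (hS.ε_law h j k)
  exact (h_neg _).prodMk (h_neg _) ((hS.ε_indep j k).comp measurable_neg measurable_neg)
    (hS.ε_indep j k)

lemma IsModel.indepFun_ε_dist (hS : S.IsModel μ) (j : Fin M) (k : ℕ) :
    IndepFun (fun ω => (S.ε (S.i j) j k ω, S.ε (S.g j) j k ω))
      (fun ω => (S.dist (S.i j) j k ω, S.dist (S.g j) j k ω)) μ :=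
  (hS.ε_indep_state j k).comp measurable_id
    ((measurable_planarDist.comp (measurable_fst.prodMk measurable_snd.snd)).prodMk
      (measurable_planarDist.comp (measurable_snd.fst.prodMk measurable_snd.snd)))

-- The two summands need not be integrable separately, so symmetry is applied to the pair.
lemma IsModel.integral_linear_noise [IsProbabilityMeasure μ] (hS : S.IsModel μ) (j : Fin M)
    (k : ℕ) :
    ∫ ω, (2 * S.dist (S.i j) j k ω * S.ε (S.i j) j k ω
      - 2 * S.dist (S.g j) j k ω * S.ε (S.g j) j k ω) ∂μ = 0 :=
  integral_eq_zero_of_odd (Φ := fun z => 2 * z.2.1 * z.1.1 - 2 * z.2.2 * z.1.2)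
    ((hS.measurable_dist _ j k).prodMk (hS.measurable_dist _ j k)).aemeasurable
    (hS.indepFun_ε_dist j k) (hS.identDistrib_neg_ε j k) (by fun_prop)
    fun a b => by simp only [Prod.fst_neg, Prod.snd_neg]; ring

lemma IsModel.integral_εbar [IsProbabilityMeasure μ] (hS : S.IsModel μ) {j : Fin M} {k : ℕ}
    (h_int : Integrable (S.εbar j k) μ) :
    ∫ ω, S.εbar j k ω ∂μ = (S.q (S.i j) : ℝ) - S.q (S.g j) := by
  have h_i := hS.integrable_ε_sq (S.i j) j k
  have h_g := hS.integrable_ε_sq (S.g j) j k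
  have h_diff : Integrable
      (fun ω => S.ε (S.i j) j k ω ^ 2 - S.ε (S.g j) j k ω ^ 2) μ := h_i.sub h_g
  have h_linear := hS.integral_linear_noise j k
  have h_eq : ∀ ω, 2 * S.dist (S.i j) j k ω * S.ε (S.i j) j k ω
      - 2 * S.dist (S.g j) j k ω * S.ε (S.g j) j k ω
      = S.εbar j k ω - (S.ε (S.i j) j k ω ^ 2 - S.ε (S.g j) j k ω ^ 2) := fun ω => by
    rw [εbar]
    ring
  simp only [h_eq] at h_linear
  rw [integral_sub h_int h_diff, integral_sub h_i h_g, hS.integral_ε_sq,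
    hS.integral_ε_sq] at h_linear
  linarith

variable {qlo qhi rlo rhi : ℝ}

lemma IsModel.integral_β_sq [IsProbabilityMeasure μ] (hS : S.IsModel μ) {j : Fin M} {k : ℕ}
    (hΥ : Var[S.εbar j k; μ] ≠ 0) :
    Integrable (fun ω => S.β j k ω ^ 2) μ ∧ ∫ ω, S.β j k ω ^ 2 ∂μ = Var[S.εbar j k; μ] := by
  -- An infinite second moment would give the junk value `Var = 0`.
  have h_memLp : MemLp (S.εbar j k) 2 μ :=
    memLp_two_of_variance_ne_zero (hS.measurable_εbar j k).aestronglyMeasurable hΥ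
  have hβ : MemLp (S.β j k) 2 μ := h_memLp.sub (memLp_const _)
  refine ⟨hβ.integrable_sq, ?_⟩
  rw [variance_eq_integral h_memLp.aemeasurable,
    hS.integral_εbar (h_memLp.integrable (by norm_num))]
  rfl

lemma IsModel.integral_acc_sq (hS : S.IsModel μ) (j : Fin M) (k : ℕ) :
    Integrable (fun ω => S.acc j k ω ⬝ᵥ S.acc j k ω) μ ∧
      ∫ ω, S.acc j k ω ⬝ᵥ S.acc j k ω ∂μ = ∫ z, ‖z‖ ^ 2 ∂(multivariateGaussian 0 (S.Q j)) := by
  have h_law := hS.acc_law j k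
  have h_eq : ∀ ω, S.acc j k ω ⬝ᵥ S.acc j k ω = ‖WithLp.toLp 2 (S.acc j k ω)‖ ^ 2 := fun ω =>
    (eNorm_sq _).symm
  simp only [h_eq]
  exact ⟨h_law.hasGaussianLaw.memLp_two.integrable_norm_pow (by norm_num),
    h_law.integral_comp (f := fun z => ‖z‖ ^ 2) (by fun_prop)⟩

lemma IsModel.exists_integral_noiseSize_le [IsProbabilityMeasure μ] (hS : S.IsModel μ)
    (hqlo : 0 < qlo) (hrlo : 0 < rlo) (h : S.NoiseBounds μ qlo qhi rlo rhi) (j : Fin M) :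
    ∃ b : ℝ, 0 ≤ b ∧ ∀ k,
      Integrable (fun ω => KalmanFilter.noiseSize qlo rlo (fun l => S.acc j l ω)
        (fun l => S.β j l ω) k) μ ∧
      ∫ ω, KalmanFilter.noiseSize qlo rlo (fun l => S.acc j l ω) (fun l => S.β j l ω) k ∂μ
        ≤ b := by
  have h_rhi : 0 ≤ rhi := hrlo.le.trans ((h.Υ_lo j 0).trans (h.Υ_hi j 0))
  refine ⟨(∫ z, ‖z‖ ^ 2 ∂(multivariateGaussian 0 (S.Q j))) / qlo + rhi / rlo,
    by positivity, fun k => ?_⟩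
  obtain ⟨h_acc, h_acc_eq⟩ := hS.integral_acc_sq j k
  obtain ⟨h_β, h_β_eq⟩ := hS.integral_β_sq (hrlo.trans_le (h.Υ_lo j (k + 1))).ne'
  refine ⟨(h_acc.div_const qlo).add (h_β.div_const rlo), ?_⟩
  simp only [KalmanFilter.noiseSize]
  rw [integral_add (h_acc.div_const qlo) (h_β.div_const rlo), integral_div, integral_div,
    h_acc_eq, h_β_eq]
  gcongr
  exact h.Υ_hi j (k + 1)

end Moments

section VarianceBounds

variable {qlo qhi rlo rhi c : ℝ}

lemma IsModel.exists_smul_one_le_ζ (hS : S.IsModel μ) (hqlo : 0 < qlo) (hrlo : 0 < rlo)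
    (hc : 0 ≤ c) (h : S.NoiseBounds μ qlo qhi rlo rhi) (hp : S.GroupBounded μ c) (j : Fin M) :
    ∃ z : ℝ, 0 < z ∧ ∀ᵐ ω ∂μ, ∀ k, z • 1 ≤ S.ζ j k ω := by
  obtain ⟨z, hz, hζ⟩ := KalmanFilter.exists_smul_one_le_Z (ctrlGram_two_posDef hS.t_pos.ne')
    (isUnit_A₂ S.t) hqlo (h.Q_lo j) (hS.ζ₀_pos j) hrlo (by positivity : 0 ≤ 4 * c)
  refine ⟨z, hz, ?_⟩
  filter_upwards [h.Υhat_lo j, hp j] with ω hR hp k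
  have h_run := hζ (S.run j ω) hR (fun k => C_dotProduct_self_le hc (hp k)) k
  rwa [run_Z] at h_run

lemma VarianceBounded.exists_ζ_le (hS : S.IsModel μ) {j : Fin M} (h : S.VarianceBounded μ j) :
    ∃ z : ℝ, 0 < z ∧ ∀ᵐ ω ∂μ, ∀ k, S.ζ j k ω ≤ z • 1 := by
  obtain ⟨zlo, hzlo, _, -, h⟩ := h
  obtain ⟨z₀, hz₀, hζ₀⟩ := exists_le_smul_one (hS.ζ₀_pos j).isHermitian
  refine ⟨z₀ + zlo⁻¹, by positivity, ?_⟩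
  filter_upwards [h] with ω hω k
  have hzlo_inv : 0 < zlo⁻¹ := inv_pos.2 hzlo
  rcases k.eq_zero_or_pos with rfl | hk
  · exact hζ₀.trans (smul_one_mono (by linarith))
  · exact (le_smul_one_of_smul_one_le_inv hzlo (hω k hk).1).trans (smul_one_mono (by linarith))

lemma IsModel.varianceBounded_of_ζ_le (hS : S.IsModel μ) (hqlo : 0 < qlo) (hrlo : 0 < rlo)
    (hc : 0 ≤ c) (h : S.NoiseBounds μ qlo qhi rlo rhi) (hp : S.GroupBounded μ c) {j : Fin M}
    {z : ℝ} (hz : 0 < z) (hζ : ∀ᵐ ω ∂μ, ∀ k, 0 < k → S.ζ j k ω ≤ z • 1) :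
    S.VarianceBounded μ j := by
  obtain ⟨z₁, hz₁, hζ₁⟩ := hS.exists_smul_one_le_ζ hqlo hrlo hc h hp j
  refine ⟨z⁻¹, inv_pos.2 hz, z₁⁻¹, inv_pos.2 hz₁, ?_⟩
  filter_upwards [hζ, hζ₁] with ω h_le h_ge k hk
  exact ⟨smul_one_le_inv (posDef_of_smul_one_le hz₁ (h_ge k)) hz (h_le k hk),
    inv_le_smul_one hz₁ (h_ge k)⟩

end VarianceBounds

section MeanSquare

variable {qlo qhi rlo rhi c : ℝ}

lemma IsModel.exists_e_dotProduct_self_le_majorant (hS : S.IsModel μ) (hqlo : 0 < qlo)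
    (hrlo : 0 < rlo) (hc : 0 ≤ c) (h : S.NoiseBounds μ qlo qhi rlo rhi)
    (hp : S.GroupBounded μ c) {j : Fin M} (hj : S.VarianceBounded μ j) :
    ∃ z₀ z r D : ℝ, 0 < z ∧ 0 ≤ r ∧ r < 1 ∧ 0 ≤ D ∧ ∀ᵐ ω ∂μ, ∀ k,
      S.e j k ω ⬝ᵥ S.e j k ω ≤ z * majorant r D ((S.e j 0 ω ⬝ᵥ S.e j 0 ω) / z₀)
        (KalmanFilter.noiseSize qlo rlo (fun l => S.acc j l ω) (fun l => S.β j l ω)) k := by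
  obtain ⟨z₀, hz₀, hζ₀⟩ := exists_smul_one_le (hS.ζ₀_pos j)
  obtain ⟨z, hz, hζ⟩ := hj.exists_ζ_le hS
  obtain ⟨r, D, hr, hr₁, hD, h_path⟩ := KalmanFilter.exists_dotProduct_self_le_majorant
    two_pos (ctrlGram_two_posDef hS.t_pos.ne') hqlo (h.Q_lo j) hrlo
    (by positivity : 0 ≤ 4 * c) hz₀ hζ₀ hz
  refine ⟨z₀, z, r, D, hz, hr, hr₁, hD, ?_⟩
  filter_upwards [h.Υhat_lo j, hp j, hζ] with ω hR hp hζ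
  exact h_path (hS.isError j ω) hR (fun k => C_dotProduct_self_le hc (hp k))
    fun k => (run_Z j k ω).trans_le (hζ k)

lemma IsModel.exists_integral_e_sq_le [IsProbabilityMeasure μ] (hS : S.IsModel μ) (hqlo : 0 < qlo)
    (hrlo : 0 < rlo) (hc : 0 ≤ c) (h : S.NoiseBounds μ qlo qhi rlo rhi)
    (hp : S.GroupBounded μ c) {j : Fin M} (hj : S.VarianceBounded μ j) :
    ∃ δ : ℝ, 0 ≤ δ ∧ ∀ k, Integrable (fun ω => eNorm (S.e j k ω) ^ 2) μ ∧
      ∫ ω, eNorm (S.e j k ω) ^ 2 ∂μ ≤ δ := by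
  obtain ⟨z₀, z, r, D, hz, hr, hr₁, hD, h_path⟩ :=
    hS.exists_e_dotProduct_self_le_majorant hqlo hrlo hc h hp hj
  obtain ⟨b, hb, hν⟩ := hS.exists_integral_noiseSize_le hqlo hrlo h j
  have h_initial : Integrable (fun ω => (S.e j 0 ω ⬝ᵥ S.e j 0 ω) / z₀) μ := by
    simp only [← eNorm_sq]
    exact ((hS.init_sq j).integrable_norm_pow (by norm_num)).div_const z₀
  have h_majorant := integral_majorant_le hr hr₁ hD hb h_initial hν
  have : 0 < 1 - r := sub_pos.2 hr₁
  refine ⟨z * (D * |∫ ω, (S.e j 0 ω ⬝ᵥ S.e j 0 ω) / z₀ ∂μ| + D * b / (1 - r)),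
    by positivity, fun k => ?_⟩
  simp only [eNorm_sq]
  obtain ⟨h_int, h_le⟩ := h_majorant k
  have h_meas := measurable_dotProduct (hS.measurable_e j k) (hS.measurable_e j k)
  have h_e_int : Integrable (fun ω => S.e j k ω ⬝ᵥ S.e j k ω) μ := by
    refine (h_int.const_mul z).mono' h_meas.aestronglyMeasurable ?_
    filter_upwards [h_path] with ω hω
    rw [Real.norm_of_nonneg (dotProduct_self_nonneg _)]
    exact hω k
  refine ⟨h_e_int, ?_⟩
  calc ∫ ω, S.e j k ω ⬝ᵥ S.e j k ω ∂μ
      ≤ ∫ ω, z * majorant r D ((S.e j 0 ω ⬝ᵥ S.e j 0 ω) / z₀) (KalmanFilter.noiseSize qlo rlo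
          (fun l => S.acc j l ω) (fun l => S.β j l ω)) k ∂μ :=
        integral_mono_ae h_e_int (h_int.const_mul z) (h_path.mono fun ω hω => hω k)
    _ ≤ _ := by
        rw [integral_const_mul]
        exact mul_le_mul_of_nonneg_left h_le hz.le

lemma IsModel.meanSquareBounded [IsProbabilityMeasure μ] (hS : S.IsModel μ) (hqlo : 0 < qlo)
    (hrlo : 0 < rlo) (hc : 0 ≤ c) (h : S.NoiseBounds μ qlo qhi rlo rhi)
    (hp : S.GroupBounded μ c) (h_var : ∀ j, S.VarianceBounded μ j) : S.MeanSquareBounded μ := by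
  choose δ hδ h_sq using fun j => hS.exists_integral_e_sq_le hqlo hrlo hc h hp (h_var j)
  exact ⟨∑ j, δ j, Finset.sum_nonneg fun j _ => hδ j, fun j k => ⟨(h_sq j k).1,
    (h_sq j k).2.trans (Finset.single_le_sum (fun j _ => hδ j) (Finset.mem_univ j))⟩⟩

end MeanSquare

section Encirclement

variable {ρ : ℝ} {ℓ : ℕ} {Γaux : Fin N → ℕ → Ω → Fin 3 → ℝ} {j : Fin M}

lemma IsModel.F_mulVec_x_succ (hS : S.IsModel μ) {h : Fin N} {r : Fin 2 → ℝ} {k : ℕ} {ω : Ω}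
    (hu : S.u h k ω = S.attract h j r k ω - (2 / S.t) • S.v h k ω) :
    F *ᵥ S.x h (k + 1) ω = (fun a => S.ηhat j k ω (.inl a)) + r
      + S.t • (fun a => S.ηhat j k ω (.inr a)) := by
  have ht := hS.t_pos.ne'
  have h_succ : S.x h (k + 1) ω = S.x h k ω - Fᵀ *ᵥ (F *ᵥ S.x h k ω
      - (fun a => S.ηhat j k ω (.inl a)) - r - S.t • (fun a => S.ηhat j k ω (.inr a))) := by
    rw [hS.drone_pos, hu, attract]
    match_scalars <;> field_simp
    ring
  rw [h_succ, mulVec_sub, F_mulVec_transpose_mulVec]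
  abel

lemma IsModel.C_succ_of_quiet (hS : S.IsModel μ) (henc : S.Encircles ρ ℓ Γaux j) {k : ℕ} {ω : Ω}
    (hi : Γaux (S.i j) k ω = 0) (hg : Γaux (S.g j) k ω = 0) (y : SIdx → ℝ) :
    S.C j (k + 1) ω ⬝ᵥ y
      = -4 * ρ * bearing (1 / (ℓ : ℝ) * k * Real.pi) (fun a => y (.inl a)) := by
  obtain ⟨h_ui, h_ug⟩ := henc k ω
  rw [hi, add_zero] at h_ui
  rw [hg, add_zero] at h_ug
  have h_p : F *ᵥ S.p j (k + 1) ω = (2 : ℝ) • shape ρ ℓ k := by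
    rw [p, mulVec_sub, hS.F_mulVec_x_succ h_ui, hS.F_mulVec_x_succ h_ug, two_smul]
    abel
  rw [C, outRow, h_p, dotProduct_SIdx, bearing]
  simp only [shape, Sum.elim_inl, Sum.elim_inr, Pi.smul_apply, Pi.zero_apply, smul_eq_mul,
    cons_val_zero, cons_val_one]
  ring

lemma sin_pi_div_pos (hℓ : 1 < ℓ) : 0 < Real.sin (1 / (ℓ : ℝ) * Real.pi) := by
  have h_inv : 1 / (ℓ : ℝ) < 1 := by
    rw [div_lt_one (by positivity)]
    exact_mod_cast hℓ
  exact Real.sin_pos_of_pos_of_lt_pi (by positivity) (mul_lt_of_lt_one_left Real.pi_pos h_inv)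

lemma IsModel.exists_smul_one_le_obsGram_of_quiet (hS : S.IsModel μ) (hρ : ρ ≠ 0) (hℓ : 1 < ℓ)
    (henc : S.Encircles ρ ℓ Γaux j) :
    ∃ a : ℝ, 0 < a ∧ ∀ k ω,
      (∀ n, k ≤ n → n ≤ k + 3 → Γaux (S.i j) n ω = 0 ∧ Γaux (S.g j) n ω = 0) →
      a • 1 ≤ obsGram (A₂ S.t) (fun k => S.C j k ω) k 4 := by
  obtain ⟨a, ha, h_gram⟩ := exists_smul_one_le_obsGram_of_bearing hS.t_pos.ne'
    (mul_ne_zero (by norm_num : (-4 : ℝ) ≠ 0) hρ) (sin_pi_div_pos hℓ)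
  refine ⟨a, ha, fun k ω h_quiet => h_gram _ k (1 / (ℓ : ℝ) * k * Real.pi) fun i hi y => ?_⟩
  obtain ⟨h_i, h_g⟩ := h_quiet (k + i) (by omega) (by omega)
  rw [hS.C_succ_of_quiet henc h_i h_g]
  congr 2
  push_cast
  ring

lemma IsModel.varianceBounded_of_encircles (hS : S.IsModel μ) {qlo qhi rlo rhi c : ℝ}
    (hqlo : 0 < qlo) (hqhi : 0 < qhi) (hrlo : 0 < rlo) (hrhi : 0 < rhi) (hc : 0 ≤ c)
    (h : S.NoiseBounds μ qlo qhi rlo rhi) (hp : S.GroupBounded μ c) (hρ : ρ ≠ 0) (hℓ : 1 < ℓ)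
    (henc : S.Encircles ρ ℓ Γaux j) (hqw : S.QuietWindows μ Γaux j) : S.VarianceBounded μ j := by
  obtain ⟨m₁, -, h_windows⟩ := hqw
  obtain ⟨a, ha, h_gram⟩ := hS.exists_smul_one_le_obsGram_of_quiet hρ hℓ henc
  have hQ := (posDef_of_smul_one_le hqlo (h.Q_lo j)).posSemidef
  obtain ⟨z, hz, hζ⟩ := KalmanFilter.exists_Z_le_of_frequently_observable (B := B₂ S.t)
    (isUnit_A₂ S.t) hqhi hrhi (by positivity : 0 ≤ 4 * c) ha hQ
    (hS.ζ₀_pos j).posSemidef (h.Q_hi j) 4 m₁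
  refine hS.varianceBounded_of_ζ_le hqlo hrlo hc h hp hz ?_
  filter_upwards [h.Υhat_lo j, h.Υhat_hi j, hp j, h_windows] with ω hR hRhi hp h_windows k _
  rw [← run_Z]
  refine hζ (S.run j ω) (fun k => hrlo.trans_le (hR k)) hRhi
    (fun k => C_dotProduct_self_le hc (hp k)) (fun k hk => ?_) k
  obtain ⟨k₁, h_start, h_end, h_quiet⟩ := h_windows (k - 1) (by omega)
  exact ⟨k₁, by omega, by omega, h_gram k₁ ω h_quiet⟩

end Encirclement

end Scenario

end DTSE

end

theorem theorem1_general {Ω : Type*} [MeasurableSpace Ω] (μ : MeasureTheory.Measure Ω)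
    [MeasureTheory.IsProbabilityMeasure μ] {M N : ℕ} (S : DTSE.Scenario Ω M N)
    (hS : S.IsModel μ)
    (qlo qhi rlo rhi c : ℝ) (hqlo : 0 < qlo) (hqhi : 0 < qhi) (hrlo : 0 < rlo) (hrhi : 0 < rhi)
    (hc : 0 ≤ c)
    (hnoise : S.NoiseBounds μ qlo qhi rlo rhi)
    (hgroup : S.GroupBounded μ c) :
    ((∀ j, S.VarianceBounded μ j) → S.MeanSquareBounded μ) ∧
    (∀ (ρ : ℝ) (ℓ : ℕ) (Γaux : Fin N → ℕ → Ω → Fin 3 → ℝ), ρ ≠ 0 → 1 < ℓ →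
      ∀ j, S.Encircles ρ ℓ Γaux j → S.QuietWindows μ Γaux j → S.VarianceBounded μ j) := by
  refine ⟨fun h_var => hS.meanSquareBounded hqlo hrlo hc hnoise hgroup h_var, ?_⟩
  intro ρ ℓ Γaux hρ hℓ j henc hqw
  exact hS.varianceBounded_of_encircles hqlo hqhi hrlo hrhi hc hnoise hgroup hρ hℓ henc hqw

theorem theorem1 {Ω : Type*} [MeasurableSpace Ω] (μ : MeasureTheory.Measure Ω)
    [MeasureTheory.IsProbabilityMeasure μ] {M N : ℕ} (S : DTSE.Scenario Ω M N)
    (hS : S.IsModel μ)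
    (qlo qhi rlo rhi c : ℝ) (hqlo : 0 < qlo) (hqhi : 0 < qhi) (hrlo : 0 < rlo) (hrhi : 0 < rhi)
    (hc : 0 < c)
    (hnoise : S.NoiseBounds μ qlo qhi rlo rhi)
    (hgroup : S.GroupBounded μ c) :
    ((∀ j, S.VarianceBounded μ j) → S.MeanSquareBounded μ) ∧
    (∀ (ρ : ℝ) (ℓ : ℕ) (Γaux : Fin N → ℕ → Ω → Fin 3 → ℝ), 0 < ρ → 4 ≤ ℓ →
      ∀ j, S.Encircles ρ ℓ Γaux j → S.QuietWindows μ Γaux j → S.VarianceBounded μ j) := by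
  obtain ⟨h_ms, h_var⟩ :=
    theorem1_general μ S hS qlo qhi rlo rhi c hqlo hqhi hrlo hrhi hc.le hnoise hgroup
  exact ⟨h_ms, fun ρ ℓ Γaux hρ hℓ => h_var ρ ℓ Γaux hρ.ne' (by omega)⟩
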